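/- Let $\mathbb F_4$ be the field with four elements, with conjugation $\overline a=a^2$, and for $u,v\in\mathbb F_4^n$ put $\langle u,v\rangle_H=\sum_{i=1}^n u_i\overline{v_i}$. A quaternary linear $[n,k,d]$ code is a $k$-dimensional subspace $C\subseteq\mathbb F_4^n$ whose nonzero words have minimum Hamming weight exactly $d$. Its Hermitian dual is $C^{\perp_H}=\{v\in\mathbb F_4^n : \langle u,v\rangle_H=0 \text{ for all } u\in C\}$ and its Hermitian hull is $\mathrm{Hull}_H(C)=C\cap C^{\perp_H}$. Let $D_4(n,k)$ be the largest $d$ for which a quaternary linear $[n,k,d]$ code exists, and let $D_4^H(n,k,1)$ be the largest $d$ for which a quaternary linear $[n,k,d]$ code $C$ with $\dim\mathrm{Hull}_H(C)=1$ exists. Then for all integers $1\le k<n\le 12$ the number $D_4^H(n,k,1)$ exists (that is, some $[n,k]$ code has one-dimensional Hermitian hull) and equals the entry in row $n$ and column $k$ of the following table: $$\begin{array}{c|ccccccccccc} n\backslash k&1&2&3&4&5&6&7&8&9&10&11\\\hline 2&2\\ 3&2&1\\ 4&4&3&2\\ 5&4&3&2&1\\ 6&6&4&3&2&2\\ 7&6&5&4&3&2&1\\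 8&8&5&5&4&3&2&2\\ 9&8&7&6&5&4&3&2&1\\ 10&10&7&6&5&5&4&3&2&2\\ 11&10&8&7&6&5&4&4&3&2&1\\ 12&12&9&8&7&6&6&4&4&3&2&2 \end{array}$$ Moreover, $D_4^H(n,k,1)<D_4(n,k)$ for $(n,k)\in\{(10,4),(11,5),(11,6)\}$. -/

import Mathlib

/-- The field with four elements. -/
abbrev F4 : Type := GaloisField 2 2

namespace Quaternary

/-- The Hermitian form `∑ uᵢ * conj vᵢ` on `F4ⁿ`, where the conjugate of `a` is `a ^ 2`. -/
noncomputable def hermInner {n : ℕ} (u v : Fin n → F4) : F4 :=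
  ∑ i, u i * v i ^ 2

/-- The Hermitian dual `{v | ⟨u, v⟩ = 0 for all u ∈ C}`. -/
noncomputable def hermDual {n : ℕ} (C : Submodule F4 (Fin n → F4)) :
    Submodule F4 (Fin n → F4) where
  carrier := {v | ∀ u ∈ C, hermInner u v = 0}
  zero_mem' := by
    intro u _
    simp [hermInner]
  add_mem' := by
    intro v w hv hw u hu
    have sq : ∀ a b : F4, (a + b) ^ 2 = a ^ 2 + b ^ 2 := fun a b => add_pow_char a b 2
    have h : hermInner u (v + w) = hermInner u v + hermInner u w := by
      simp only [hermInner, Pi.add_apply, sq, mul_add, Finset.sum_add_distrib]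
    rw [h, hv u hu, hw u hu, add_zero]
  smul_mem' := by
    intro a v hv u hu
    have h : hermInner u (a • v) = a ^ 2 * hermInner u v := by
      simp only [hermInner, Pi.smul_apply, smul_eq_mul, Finset.mul_sum]
      exact Finset.sum_congr rfl fun i _ => by ring
    rw [h, hv u hu, mul_zero]

/-- The Hermitian hull `C ∩ C^⊥`. -/
noncomputable def hermHull {n : ℕ} (C : Submodule F4 (Fin n → F4)) :
    Submodule F4 (Fin n → F4) :=
  C ⊓ hermDual C

open Classical in
/-- `C` is an `[n, k, d]` code: its dimension is `k` and `d` is the minimum Hamming weight of its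
nonzero words. -/
def IsCode (n k d : ℕ) (C : Submodule F4 (Fin n → F4)) : Prop :=
  Module.finrank F4 C = k ∧ IsLeast {w | ∃ c ∈ C, c ≠ 0 ∧ hammingNorm c = w} d

/-- `D = D₄(n, k)`: `D` is the largest `d` for which an `[n, k, d]` code exists. -/
def IsD4 (n k D : ℕ) : Prop :=
  IsGreatest {d | ∃ C : Submodule F4 (Fin n → F4), IsCode n k d C} D

/-- `D = D₄ᴴ(n, k, l)`: `D` is the largest `d` for which an `[n, k, d]` code with `l`-dimensional
Hermitian hull exists. -/
def IsD4H (n k l D : ℕ) : Prop :=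
  IsGreatest {d | ∃ C : Submodule F4 (Fin n → F4),
    IsCode n k d C ∧ Module.finrank F4 (hermHull C) = l} D

/-- Row `n` of the table of values `D₄ᴴ(n, k, 1)`, listed for `k = 1, …, n - 1`. -/
def tableRow : ℕ → List ℕ
  | 2 => [2]
  | 3 => [2, 1]
  | 4 => [4, 3, 2]
  | 5 => [4, 3, 2, 1]
  | 6 => [6, 4, 3, 2, 2]
  | 7 => [6, 5, 4, 3, 2, 1]
  | 8 => [8, 5, 5, 4, 3, 2, 2]
  | 9 => [8, 7, 6, 5, 4, 3, 2, 1]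
  | 10 => [10, 7, 6, 5, 5, 4, 3, 2, 2]
  | 11 => [10, 8, 7, 6, 5, 4, 4, 3, 2, 1]
  | 12 => [12, 9, 8, 7, 6, 6, 4, 4, 3, 2, 2]
  | _ => []

/-- The table entry in row `n` and column `k`, for `1 ≤ k < n ≤ 12`. -/
def tableEntry (n k : ℕ) : ℕ :=
  (tableRow n).getD (k - 1) 0

end Quaternary

namespace Quaternary

section
open scoped Classical

/-! Upper bounds that hold for all codes come from length, the Plotkin bound in dimension two, and
shortening. Five sporadic parameter sets need more: two follow from the weight distribution, three
from passing to the dual code. Codes are taken to be supported on `m` coordinates of a possibly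
longer space, so that a shortened code stays in the same space. The main tool is
`sum_weightCount_mul_choose`: counting the pairs of a word and `t` of its zeros gives the `t`-th
binomial moment of the weight distribution whenever known bounds prevent shortenings from being too
large.

The hull enters through one further linear equation. Since `⟨c, c⟩` is the weight of `c` modulo two,
`(-1) ^ weight` is a quadratic character, and its sum over `C` is a Gauss sum whose square is `4 ^
(k + l)`, with `l` the hull dimension. Nonzero words come in triples of scalar multiples, so the sum
is `1` modulo `3`; this fixes the sign and gives `(-2) ^ (k + l)` (`signedCount_eq`). For most
parameters where hull dimension one costs distance, this equation and the moments have no solution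
in natural numbers.

Three cases remain. For `[10, 4, 6]` the hull dimensions of the one-coordinate shortenings determine
their numbers of words of weight nine; summing these forces the hull generator to have weight four.
For `[11, 5, 6]` the same count gives a hull generator `h` of weight six. Modulo `h` the code has an
explicit basis on the five zeros of `h`, and on the support of `h` it yields four vectors of length
six subject to weight conditions, which a finite search rules out (`not_compatible`). An `[11, 6,
5]` code reduces to this case, because its Hermitian dual is an `[11, 5]` code of minimum distance
at least six with the same hull.

The lower bounds are explicit systematic generator matrices, each with an isotropic vector and
orthonormal vectors that together form a basis of the code. -/

noncomputable instance : Fintype F4 := Fintype.ofFinite F4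

/-! ### Arithmetic in the field with four elements -/

lemma F4_card : Fintype.card F4 = 4 := by
  have h := GaloisField.card 2 2 two_ne_zero
  rw [Nat.card_eq_fintype_card] at h
  exact h

lemma F4_pow_four (x : F4) : x ^ 4 = x := by
  have h := FiniteField.pow_card x
  rwa [F4_card] at h

lemma F4_pow_three {x : F4} (hx : x ≠ 0) : x ^ 3 = 1 := by
  have h := F4_pow_four x
  have h2 : x * (x ^ 3 - 1) = 0 := by linear_combination h
  rcases mul_eq_zero.1 h2 with h3 | h3
  · exact absurd h3 hx
  · exact sub_eq_zero.1 h3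

lemma F4_two : (2 : F4) = 0 := CharTwo.two_eq_zero

lemma exists_primitive : ∃ ω : F4, ω ^ 2 + ω + 1 = 0 := by
  have h : ∃ x : F4, x ∉ ({0, 1} : Finset F4) := by
    by_contra! h
    have h1 : (Finset.univ : Finset F4) ⊆ {0, 1} := fun x _ => h x
    have h2 := (Finset.card_le_card h1).trans Finset.card_le_two
    rw [Finset.card_univ, F4_card] at h2
    omega
  obtain ⟨x, hx⟩ := h
  simp only [Finset.mem_insert, Finset.mem_singleton, not_or] at hx
  refine ⟨x, ?_⟩
  have h3 := F4_pow_three hx.1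
  have h2 : (x - 1) * (x ^ 2 + x + 1) = 0 := by linear_combination h3
  exact (mul_eq_zero.1 h2).resolve_left (sub_ne_zero.2 hx.2)

/-- A primitive element of the field with four elements. -/
noncomputable def ω : F4 := exists_primitive.choose

lemma ω_sq : ω ^ 2 = ω + 1 := by
  have h : ω ^ 2 + ω + 1 = 0 := exists_primitive.choose_spec
  linear_combination h - (ω + 1) * F4_two

lemma ω_ne_zero : ω ≠ 0 := by
  intro h
  have := ω_sq
  simp [h] at this

lemma ω_ne_one : ω ≠ 1 := by
  intro h
  have := ω_sq
  rw [h, one_pow, one_add_one_eq_two, F4_two] at this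
  exact one_ne_zero this

lemma ω_add_one_ne_zero : ω + 1 ≠ 0 := by
  rw [← ω_sq]
  exact pow_ne_zero 2 ω_ne_zero

lemma F4_cases (x : F4) : x = 0 ∨ x = 1 ∨ x = ω ∨ x = ω + 1 := by
  by_cases h0 : x = 0
  · exact Or.inl h0
  have h3 := F4_pow_three h0
  have h : (x - 1) * ((x - ω) * (x - (ω + 1))) = 0 := by
    linear_combination h3 + (x - 1) * ω_sq + (-(ω + 1) * x ^ 2 + (2 * ω + 1) * x - ω) * F4_two
  rcases mul_eq_zero.1 h with h | h
  · exact Or.inr (Or.inl (sub_eq_zero.1 h))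
  rcases mul_eq_zero.1 h with h | h
  · exact Or.inr (Or.inr (Or.inl (sub_eq_zero.1 h)))
  · exact Or.inr (Or.inr (Or.inr (sub_eq_zero.1 h)))

lemma F4_add_sq (a b : F4) : (a + b) ^ 2 = a ^ 2 + b ^ 2 := add_pow_char a b 2

/-! ### Weights, words and shortened codes -/

variable {n : ℕ}

/-- The Hamming weight of a vector. -/
noncomputable def weight (c : Fin n → F4) : ℕ := hammingNorm c

lemma weight_eq (c : Fin n → F4) : weight c = (Finset.univ.filter fun i => c i ≠ 0).card := rfl

lemma weight_le (c : Fin n → F4) : weight c ≤ n := by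
  simpa [weight] using hammingNorm_le_card_fintype (x := c)

lemma weight_zero : weight (0 : Fin n → F4) = 0 := hammingNorm_zero

lemma weight_eq_zero {c : Fin n → F4} : weight c = 0 ↔ c = 0 := hammingNorm_eq_zero

lemma weight_smul {a : F4} (ha : a ≠ 0) (c : Fin n → F4) : weight (a • c) = weight c := by
  simp [weight_eq, ha]

/-- The words of `C` as a finite set. -/
noncomputable def words (C : Submodule F4 (Fin n → F4)) : Finset (Fin n → F4) :=
  Finset.univ.filter (· ∈ C)

@[simp] lemma mem_words {C : Submodule F4 (Fin n → F4)} {c : Fin n → F4} :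
    c ∈ words C ↔ c ∈ C := by simp [words]

lemma card_words (C : Submodule F4 (Fin n → F4)) :
    (words C).card = 4 ^ Module.finrank F4 C := by
  have h : Fintype.card C = _ := Module.card_eq_pow_finrank (K := F4) (V := C)
  rw [F4_card] at h
  rw [← h, words, Fintype.card_subtype]

/-- The number of words of weight `w` in `C`. -/
noncomputable def weightCount (C : Submodule F4 (Fin n → F4)) (w : ℕ) : ℕ :=
  ((words C).filter fun c => weight c = w).card

/-- The words of `C` vanishing on the coordinates in `T`. -/
noncomputable def shorten (C : Submodule F4 (Fin n → F4)) (T : Finset (Fin n)) :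
    Submodule F4 (Fin n → F4) where
  carrier := {c | c ∈ C ∧ ∀ i ∈ T, c i = 0}
  zero_mem' := ⟨C.zero_mem, fun _ _ => rfl⟩
  add_mem' := fun ha hb => ⟨C.add_mem ha.1 hb.1, fun i hi => by simp [ha.2 i hi, hb.2 i hi]⟩
  smul_mem' := fun a _ hc => ⟨C.smul_mem a hc.1, fun i hi => by simp [hc.2 i hi]⟩

lemma mem_shorten {C : Submodule F4 (Fin n → F4)} {T : Finset (Fin n)} {c : Fin n → F4} :
    c ∈ shorten C T ↔ c ∈ C ∧ ∀ i ∈ T, c i = 0 := Iff.rfl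

lemma shorten_le (C : Submodule F4 (Fin n → F4)) (T : Finset (Fin n)) : shorten C T ≤ C :=
  fun _ hc => hc.1

/-- The kernel of a linear map on `C` into a `t`-dimensional space has codimension at most `t`. -/
lemma finrank_le_of_ker {C D : Submodule F4 (Fin n → F4)} {W : Type*} [AddCommGroup W]
    [Module F4 W] [FiniteDimensional F4 W] (f : C →ₗ[F4] W)
    (h : ∀ c : C, f c = 0 → (c : Fin n → F4) ∈ D) :
    Module.finrank F4 C ≤ Module.finrank F4 D + Module.finrank F4 W := by
  have h1 := LinearMap.finrank_range_add_finrank_ker f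
  have h2 := Submodule.finrank_le (LinearMap.range f)
  have h3 : Module.finrank F4 (LinearMap.ker f) ≤ Module.finrank F4 D := by
    refine LinearMap.finrank_le_finrank_of_injective
      (f := LinearMap.codRestrict D (C.subtype ∘ₗ (LinearMap.ker f).subtype) fun c => h _ c.2) ?_
    intro a b hab
    have h' : ((a : C) : Fin n → F4) = ((b : C) : Fin n → F4) :=
      congrArg (fun x : D => (x : Fin n → F4)) hab
    exact Subtype.ext (Subtype.ext h')
  omega

lemma finrank_le_finrank_shorten (C : Submodule F4 (Fin n → F4)) (T : Finset (Fin n)) :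
    Module.finrank F4 C ≤ Module.finrank F4 (shorten C T) + T.card := by
  have h := finrank_le_of_ker (C := C) (D := shorten C T) (W := T → F4)
    (LinearMap.pi fun i => (LinearMap.proj (i : Fin n)) ∘ₗ C.subtype) (by
      intro c hc
      refine ⟨c.2, fun i hi => ?_⟩
      have := congrFun hc ⟨i, hi⟩
      simpa using this)
  simpa using h

lemma exists_le_finrank_eq {C : Submodule F4 (Fin n → F4)} {k : ℕ}
    (hk : k ≤ Module.finrank F4 C) : ∃ D ≤ C, Module.finrank F4 D = k := by
  obtain ⟨s, hs, hli⟩ := exists_finset_linearIndependent_of_le_finrank hk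
  refine ⟨(Submodule.span F4 (s : Set C)).map C.subtype, Submodule.map_subtype_le _ _, ?_⟩
  rw [(Submodule.equivMapOfInjective _ C.injective_subtype _).symm.finrank_eq,
    finrank_span_finset_eq_card hli, hs]

/-! ### Excluded parameters and shortening -/

/-- Every code of dimension `k` supported on `m` coordinates has a nonzero word of weight less
than `d`. -/
def Excluded (m k d : ℕ) : Prop :=
  ∀ (n : ℕ) (C : Submodule F4 (Fin n → F4)) (S : Finset (Fin n)), S.card = m →
    (∀ c ∈ C, ∀ i ∉ S, c i = 0) → Module.finrank F4 C = k → ∃ c ∈ C, c ≠ 0 ∧ weight c < d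

lemma Excluded.mono {m k d k' d' : ℕ} (h : Excluded m k d) (hk : k ≤ k') (hd : d ≤ d') :
    Excluded m k' d' := by
  intro n C S hS hC hf
  obtain ⟨D, hDC, hD⟩ := exists_le_finrank_eq (C := C) (k := k) (by omega)
  obtain ⟨c, hc, h0, hw⟩ := h n D S hS (fun c hc => hC c (hDC hc)) hD
  exact ⟨c, hDC hc, h0, by omega⟩

lemma Excluded.exists {m k d : ℕ} (h : Excluded m k d) {C : Submodule F4 (Fin n → F4)}
    {S : Finset (Fin n)} (hS : S.card = m) (hC : ∀ c ∈ C, ∀ i ∉ S, c i = 0)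
    (hk : k ≤ Module.finrank F4 C) : ∃ c ∈ C, c ≠ 0 ∧ weight c < d :=
  h.mono hk le_rfl n C S hS hC rfl

lemma shorten_support {C : Submodule F4 (Fin n → F4)} {S : Finset (Fin n)}
    (hC : ∀ c ∈ C, ∀ i ∉ S, c i = 0) (T : Finset (Fin n)) :
    ∀ c ∈ shorten C T, ∀ i ∉ S \ T, c i = 0 := by
  intro c hc i hi
  by_cases h : i ∈ T
  · exact hc.2 i h
  · exact hC c hc.1 i fun h' => hi (Finset.mem_sdiff.2 ⟨h', h⟩)

/-- Shortening at one coordinate of the support loses at most one dimension and keeps all weights.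
-/
lemma Excluded.lengthen {m k d : ℕ} (h : Excluded m k d) : Excluded (m + 1) (k + 1) d := by
  intro n C S hS hC hf
  obtain ⟨i, hi⟩ : S.Nonempty := Finset.card_pos.1 (by omega)
  have h1 := finrank_le_finrank_shorten C {i}
  rw [Finset.card_singleton] at h1
  obtain ⟨c, hc, h0, hw⟩ := h.exists (S := S \ {i})
    (by rw [Finset.sdiff_singleton_eq_erase, Finset.card_erase_of_mem hi]; omega)
    (shorten_support hC {i}) (by omega)
  exact ⟨c, hc.1, h0, hw⟩

lemma weight_le_card {c : Fin n → F4} {S : Finset (Fin n)} (hc : ∀ i ∉ S, c i = 0) :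
    weight c ≤ S.card := by
  rw [weight_eq]
  refine Finset.card_le_card fun i hi => ?_
  by_contra h
  exact (Finset.mem_filter.1 hi).2 (hc i h)

lemma exists_ne_zero_of_finrank_pos {C : Submodule F4 (Fin n → F4)}
    (h : 0 < Module.finrank F4 C) : ∃ c ∈ C, c ≠ 0 := by
  have : C ≠ ⊥ := by
    rintro rfl
    simp at h
  exact C.exists_mem_ne_zero_of_ne_bot this

lemma excluded_of_lt {m d : ℕ} (h : m < d) : Excluded m 1 d := by
  intro n C S hS hC hf
  obtain ⟨c, hc, h0⟩ := exists_ne_zero_of_finrank_pos (C := C) (by omega)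
  exact ⟨c, hc, h0, (weight_le_card (hC c hc)).trans_lt (by omega)⟩

lemma card_filter_eq_zero {c : Fin n → F4} {S : Finset (Fin n)} (hc : ∀ i ∉ S, c i = 0) :
    (S.filter fun i => c i = 0).card = S.card - weight c := by
  have h := Finset.card_filter_add_card_filter_not (s := S) (fun i => c i = 0)
  have h2 : (S.filter fun i => ¬ c i = 0) = Finset.univ.filter fun i => c i ≠ 0 := by
    ext i
    simp only [Finset.mem_filter, Finset.mem_univ, true_and, and_iff_right_iff_imp]
    intro hi
    by_contra h
    exact hi (hc i h)
  rw [h2, ← weight_eq] at h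
  omega

/-! ### Binomial moments of the weight distribution -/

/-- Double counting of the pairs `(c, T)` in which `c` vanishes on the `t`-set `T ⊆ S`. -/
lemma sum_choose_eq_sum_card_shorten {C : Submodule F4 (Fin n → F4)} {S : Finset (Fin n)}
    (hC : ∀ c ∈ C, ∀ i ∉ S, c i = 0) (t : ℕ) :
    ∑ c ∈ words C, (S.card - weight c).choose t =
      ∑ T ∈ S.powersetCard t, (words (shorten C T)).card := by
  have h1 : ∀ c ∈ words C, (S.card - weight c).choose t =
      ((S.powersetCard t).filter fun T => ∀ i ∈ T, c i = 0).card := by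
    intro c hc
    rw [← card_filter_eq_zero (hC c (mem_words.1 hc)), ← Finset.card_powersetCard]
    congr 1
    ext T
    simp only [Finset.mem_powersetCard, Finset.mem_filter, Finset.subset_iff]
    grind
  rw [Finset.sum_congr rfl h1]
  refine (Finset.sum_card_bipartiteAbove_eq_sum_card_bipartiteBelow
    (fun (c : Fin n → F4) (T : Finset (Fin n)) => ∀ i ∈ T, c i = 0)).trans ?_
  refine Finset.sum_congr rfl fun T _ => ?_
  congr 1
  ext c
  simp [Finset.bipartiteBelow, mem_shorten]

lemma sum_words_eq_sum_weightCount {C : Submodule F4 (Fin n → F4)} {m : ℕ}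
    (hm : ∀ c ∈ C, weight c ≤ m) {R : Type*} [CommSemiring R] (f : ℕ → R) :
    ∑ c ∈ words C, f (weight c) = ∑ w ∈ Finset.range (m + 1), (weightCount C w : R) * f w := by
  rw [← Finset.sum_fiberwise_of_maps_to (s := words C) (t := Finset.range (m + 1)) (g := weight)
    (fun c hc => Finset.mem_range.2 (Nat.lt_succ_of_le (hm c (mem_words.1 hc))))]
  refine Finset.sum_congr rfl fun w _ => ?_
  rw [Finset.sum_congr rfl (g := fun _ => f w) (fun c hc => by rw [(Finset.mem_filter.1 hc).2])]
  simp [weightCount]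

/-- If no shortening at `t` coordinates has too large a dimension, the `t`-th binomial moment of
the weight distribution is determined. -/
lemma sum_weightCount_mul_choose {C : Submodule F4 (Fin n → F4)} {S : Finset (Fin n)} {m k d : ℕ}
    (hS : S.card = m) (hC : ∀ c ∈ C, ∀ i ∉ S, c i = 0) (hk : Module.finrank F4 C = k)
    (hd : ∀ c ∈ C, c ≠ 0 → d ≤ weight c) (t : ℕ) (ht : t ≤ k)
    (hex : Excluded (m - t) (k - t + 1) d) :
    ∑ w ∈ Finset.range (m + 1), weightCount C w * (m - w).choose t =
      m.choose t * 4 ^ (k - t) := by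
  have h := sum_words_eq_sum_weightCount (C := C) (m := m)
    (fun c hc => hS ▸ weight_le_card (hC c hc)) (fun w => (m - w).choose t)
  simp only [Nat.cast_id] at h
  rw [← h, ← hS, sum_choose_eq_sum_card_shorten hC t,
    Finset.sum_congr rfl (g := fun _ => 4 ^ (k - t)), Finset.sum_const, Finset.card_powersetCard,
    smul_eq_mul]
  intro T hT
  rw [Finset.mem_powersetCard] at hT
  rw [card_words]
  congr 1
  -- The shortening has dimension at least `k - t`; `hex` forbids anything larger.
  have h1 := finrank_le_finrank_shorten C T
  by_contra hne
  obtain ⟨c, hc, h0, hw⟩ := hex.exists (C := shorten C T) (S := S \ T)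
    (by rw [Finset.card_sdiff_of_subset hT.1]; omega) (shorten_support hC T) (by omega)
  have := hd c hc.1 h0
  omega

lemma weightCount_zero (C : Submodule F4 (Fin n → F4)) : weightCount C 0 = 1 := by
  rw [weightCount, Finset.card_eq_one]
  refine ⟨0, ?_⟩
  ext c
  simp only [Finset.mem_filter, mem_words, weight_eq_zero, Finset.mem_singleton]
  constructor
  · exact fun h => h.2
  · rintro rfl
    exact ⟨C.zero_mem, rfl⟩

lemma weightCount_eq_zero {C : Submodule F4 (Fin n → F4)} {d w : ℕ}
    (hd : ∀ c ∈ C, c ≠ 0 → d ≤ weight c) (h0 : 0 < w) (hw : w < d) : weightCount C w = 0 := by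
  rw [weightCount, Finset.card_eq_zero, Finset.filter_eq_empty_iff]
  rintro c hc rfl
  have hc0 : c ≠ 0 := by
    rintro rfl
    simp [weight_zero] at h0
  have := hd c (mem_words.1 hc) hc0
  omega

/-- Multiplication by `ω` has order three and moves every nonzero word, so words of positive weight
fall into orbits of size three. -/
lemma three_dvd_weightCount (C : Submodule F4 (Fin n → F4)) {w : ℕ} (hw : w ≠ 0) :
    3 ∣ weightCount C w := by
  have hmul : ∀ c : {c // c ∈ (words C).filter fun c => weight c = w},
      ω • c.1 ∈ (words C).filter fun c => weight c = w := by
    rintro ⟨c, hc⟩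
    simp only [Finset.mem_filter, mem_words] at hc ⊢
    exact ⟨C.smul_mem _ hc.1, (weight_smul ω_ne_zero c).trans hc.2⟩
  let f : Function.End {c // c ∈ (words C).filter fun c => weight c = w} :=
    fun c => ⟨ω • c.1, hmul c⟩
  have hf : f ^ 3 ^ 1 = 1 := by
    funext c
    apply Subtype.ext
    change ω • ω • ω • c.1 = c.1
    rw [smul_smul, smul_smul, show ω * ω * ω = ω ^ 3 by ring, F4_pow_three ω_ne_zero, one_smul]
  have : Fact (Nat.Prime 3) := ⟨Nat.prime_three⟩
  have h := Equiv.Perm.card_fixedPoints_modEq hf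
  have h0 : Fintype.card (Function.fixedPoints f) = 0 := by
    rw [Fintype.card_eq_zero_iff]
    refine ⟨fun ⟨c, hc⟩ => ?_⟩
    have hc' : ω • c.1 = c.1 := congrArg Subtype.val hc
    have h1 : (ω - 1) • c.1 = 0 := by rw [sub_smul, hc', one_smul, sub_self]
    rcases smul_eq_zero.1 h1 with h2 | h2
    · exact ω_ne_one (sub_eq_zero.1 h2)
    · have := (Finset.mem_filter.1 c.2).2
      rw [h2, weight_zero] at this
      exact hw this.symm
  rw [h0, Fintype.card_coe] at h
  exact (Nat.modEq_zero_iff_dvd).1 h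

/-- Each word of weight `w` survives in the shortening at each of its `S.card - w` zeros in `S`.
This passes information on the shortenings back to `C`. -/
lemma sum_weightCount_shorten {C : Submodule F4 (Fin n → F4)} {S : Finset (Fin n)}
    (hC : ∀ c ∈ C, ∀ i ∉ S, c i = 0) (w : ℕ) :
    ∑ i ∈ S, weightCount (shorten C {i}) w = (S.card - w) * weightCount C w := by
  have h1 : ∀ i ∈ S, weightCount (shorten C {i}) w =
      (((words C).filter fun c => weight c = w).filter fun c => c i = 0).card := by
    intro i _
    rw [weightCount]
    congr 1
    ext c
    simp only [Finset.mem_filter, mem_words, mem_shorten, Finset.mem_singleton, forall_eq]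
    tauto
  rw [Finset.sum_congr rfl h1]
  refine (Finset.sum_card_bipartiteAbove_eq_sum_card_bipartiteBelow
    (fun (i : Fin n) (c : Fin n → F4) => c i = 0)).trans ?_
  rw [Finset.sum_congr rfl (g := fun _ => S.card - w)]
  · rw [Finset.sum_const, smul_eq_mul, weightCount, mul_comm]
  · intro c hc
    simp only [Finset.mem_filter, mem_words] at hc
    rw [← hc.2, ← card_filter_eq_zero (hC c hc.1)]
    rfl

/-- The Plotkin bound for two-dimensional codes. -/
lemma excluded_of_plotkin {m d : ℕ} (h : 4 * m < 5 * d) : Excluded m 2 d := by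
  intro n C S hS hC hk
  by_contra! hd
  have h1 := sum_choose_eq_sum_card_shorten hC 1
  simp only [Nat.choose_one_right] at h1
  have h2 : ∀ T ∈ S.powersetCard 1, 4 ≤ (words (shorten C T)).card := by
    intro T hT
    have h3 := finrank_le_finrank_shorten C T
    rw [(Finset.mem_powersetCard.1 hT).2, hk] at h3
    rw [card_words]
    exact Nat.le_self_pow (by omega) 4
  have h3 := Finset.card_nsmul_le_sum _ _ _ h2
  rw [Finset.card_powersetCard, Nat.choose_one_right, ← h1, smul_eq_mul] at h3
  have hz : (0 : Fin n → F4) ∈ words C := mem_words.2 C.zero_mem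
  rw [← Finset.add_sum_erase _ _ hz, weight_zero] at h3
  -- The `15` nonzero words have at most `m - d` zeros each, so `4 * m ≤ m + 15 * (m - d)`, contrary
  -- to `4 * m < 5 * d`.
  have h4 : ∀ c ∈ (words C).erase 0, S.card - weight c ≤ m - d := by
    intro c hc
    have := hd c (mem_words.1 (Finset.mem_of_mem_erase hc)) (Finset.ne_of_mem_erase hc)
    omega
  have h5 := Finset.sum_le_card_nsmul _ _ _ h4
  rw [Finset.card_erase_of_mem hz, card_words, hk, smul_eq_mul] at h5
  -- The subtraction `m - d` is truncated, so `m < d` needs its own argument.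
  by_cases hdm : d ≤ m
  · norm_num at h5
    omega
  · obtain ⟨c, hc, h0⟩ := exists_ne_zero_of_finrank_pos (C := C) (by omega)
    have h6 := hd c hc h0
    have h7 := weight_le_card (hC c hc)
    omega

/-- If the shortening of `C` at `T` has the expected dimension, the coordinates in `T` are
independent on `C`. -/
lemma exists_mem_eq_single {C : Submodule F4 (Fin n → F4)} {S : Finset (Fin n)} {m k d : ℕ}
    (hS : S.card = m) (hC : ∀ c ∈ C, ∀ i ∉ S, c i = 0) (hk : Module.finrank F4 C = k)
    (hd : ∀ c ∈ C, c ≠ 0 → d ≤ weight c) {T : Finset (Fin n)} (hT : T ⊆ S) (hTk : T.card ≤ k)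
    (hex : Excluded (m - T.card) (k - T.card + 1) d) {i : Fin n} (hi : i ∈ T) :
    ∃ c ∈ C, c i ≠ 0 ∧ ∀ j ∈ T, j ≠ i → c j = 0 := by
  by_contra! hcon
  have h1 := finrank_le_finrank_shorten C (T.erase i)
  rw [Finset.card_erase_of_mem hi] at h1
  have hpos : 0 < T.card := Finset.card_pos.2 ⟨i, hi⟩
  -- If vanishing on the rest of `T` forced vanishing at `i`, the shortening at `T` would have
  -- dimension at least `k - T.card + 1`, which `hex` forbids.
  have hle : shorten C (T.erase i) ≤ shorten C T := by
    intro c hc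
    have hci : c i = 0 := by
      by_contra hne
      obtain ⟨j, hj, hji, hcj⟩ := hcon c hc.1 hne
      exact hcj (hc.2 j (Finset.mem_erase.2 ⟨hji, hj⟩))
    refine ⟨hc.1, fun j hj => ?_⟩
    by_cases h : j = i
    · rw [h, hci]
    · exact hc.2 j (Finset.mem_erase.2 ⟨h, hj⟩)
  have h2 := Submodule.finrank_mono hle
  obtain ⟨c, hc, h0, hw⟩ := hex.exists (C := shorten C T) (S := S \ T)
    (by rw [Finset.card_sdiff_of_subset hT]; omega) (shorten_support hC T) (by omega)
  have := hd c hc.1 h0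
  omega

/-! ### Bounds from the dual code -/

/-- The vectors orthogonal to `C` for the standard bilinear form. -/
noncomputable def euclDual (C : Submodule F4 (Fin n → F4)) : Submodule F4 (Fin n → F4) where
  carrier := {v | ∀ u ∈ C, ∑ i, u i * v i = 0}
  zero_mem' := by intro u _; simp
  add_mem' := by
    intro v w hv hw u hu
    simp [mul_add, Finset.sum_add_distrib, hv u hu, hw u hu]
  smul_mem' := by
    intro a v hv u hu
    have := hv u hu
    simp only [Pi.smul_apply, smul_eq_mul, mul_left_comm _ a, ← Finset.mul_sum, this, mul_zero]

lemma le_finrank_euclDual (C : Submodule F4 (Fin n → F4)) :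
    n ≤ Module.finrank F4 (euclDual C) + Module.finrank F4 C := by
  have b := Module.finBasis F4 C
  have h := finrank_le_of_ker (C := ⊤) (D := euclDual C) (W := Fin (Module.finrank F4 C) → F4)
    (LinearMap.pi fun j => (Fintype.linearCombination F4 (fun i => (b j : Fin n → F4) i)) ∘ₗ
      (⊤ : Submodule F4 (Fin n → F4)).subtype) (by
      intro v hv u hu
      have hb : ∀ j, ∑ i, (b j : Fin n → F4) i * (v : Fin n → F4) i = 0 := by
        intro j
        have := congrFun hv j
        simpa [Fintype.linearCombination_apply, mul_comm] using this
      have hsum := congrArg (Subtype.val) (b.sum_repr ⟨u, hu⟩)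
      simp only [Submodule.coe_sum, Submodule.coe_smul] at hsum
      rw [← hsum]
      simp only [Finset.sum_apply, Pi.smul_apply, smul_eq_mul, Finset.sum_mul]
      rw [Finset.sum_comm]
      refine Finset.sum_eq_zero fun j _ => ?_
      simp only [mul_assoc, ← Finset.mul_sum, hb j, mul_zero])
  simpa using h

/-- A code whose shortenings at `e` coordinates all have the expected dimension has a dual of
minimum distance larger than `e`. -/
lemma Excluded.of_dual {m k d e : ℕ} (hdual : Excluded m (m - k) (e + 1))
    (hk : k ≤ m) (hek : e ≤ k) (hex : ∀ t ≤ e, Excluded (m - t) (k - t + 1) d) :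
    Excluded m k d := by
  intro n C S hS hC hf
  by_contra! hd
  have h1 := le_finrank_euclDual C
  have h2 := finrank_le_finrank_shorten (euclDual C) Sᶜ
  rw [Finset.card_compl, Fintype.card_fin] at h2
  have hSn : S.card ≤ n := by simpa using Finset.card_le_univ S
  obtain ⟨v, hv, h0, hw⟩ := hdual.exists (C := shorten (euclDual C) Sᶜ) (S := S) hS
    (fun c hc i hi => hc.2 i (Finset.mem_compl.2 hi)) (by omega)
  obtain ⟨i, hi⟩ : ∃ i, v i ≠ 0 := by
    by_contra! h
    exact h0 (funext h)
  have hTw : (Finset.univ.filter fun i => v i ≠ 0).card = weight v := (weight_eq v).symm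
  -- The dual word `v` has weight at most `e`, so some word of `C` meets its support in exactly one
  -- coordinate and cannot be orthogonal to it.
  obtain ⟨c, hc, hci, hcj⟩ := exists_mem_eq_single hS hC hf hd
    (T := Finset.univ.filter fun i => v i ≠ 0) (by
      intro j hj
      by_contra h
      exact (Finset.mem_filter.1 hj).2 (hv.2 j (Finset.mem_compl.2 h)))
    (by omega) (hex _ (by omega)) (i := i) (by simpa using hi)
  have hs := hv.1 c hc
  rw [Finset.sum_eq_single i] at hs
  · exact (mul_ne_zero hci hi) hs
  · intro j _ hj
    by_cases h : v j = 0
    · rw [h, mul_zero]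
    · rw [hcj j (by simpa using h) hj, zero_mul]
  · simp

end

/-! ### The table of unrestricted bounds and its sporadic entries -/

/-- Parameters excluded by the length, the Plotkin bound and shortening, starting from a list of
parameters already known to be excluded. -/
def exclude (B : List (ℕ × ℕ × ℕ)) : ℕ → ℕ → ℕ → Bool
  | _, 0, _ => false
  | m, k + 1, d => decide (m < d) || (decide (1 ≤ k) && decide (4 * m < 5 * d)) ||
      decide ((m, k + 1, d) ∈ B) || (decide (1 ≤ m) && exclude B (m - 1) k d)

/-- Excluded parameters that do not follow from the Plotkin bound by shortening. -/
def sporadic : List (ℕ × ℕ × ℕ) := [(11, 3, 8), (10, 3, 7), (6, 4, 3), (7, 4, 4), (12, 7, 5)]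

/-- The parameters whose table entry is smaller than the best distance of all codes. -/
def hullSensitive : List (ℕ × ℕ) :=
  [(3, 1), (5, 1), (7, 1), (9, 1), (11, 1), (3, 2), (5, 4), (7, 6), (9, 8), (11, 10),
    (5, 2), (5, 3), (6, 3), (8, 2), (10, 2), (10, 4), (11, 5), (11, 6)]

lemma exclude_tableEntry_or : ∀ n ∈ List.range 13, ∀ k ∈ List.range n, 1 ≤ k →
    exclude sporadic n k (tableEntry n k + 1) = true ∨ (n, k) ∈ hullSensitive := by
  decide +kernel

section
open scoped Classical
variable {n : ℕ}

lemma excluded_of_exclude {B : List (ℕ × ℕ × ℕ)} (hB : ∀ b ∈ B, Excluded b.1 b.2.1 b.2.2)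
    {m k d : ℕ} (h : exclude B m k d = true) : Excluded m k d := by
  induction k generalizing m with
  | zero => simp [exclude] at h
  | succ k ih =>
    simp only [exclude, Bool.or_eq_true, Bool.and_eq_true, decide_eq_true_eq] at h
    rcases h with ((h | h) | h) | h
    · exact (excluded_of_lt h).mono (by omega) le_rfl
    · exact (excluded_of_plotkin h.2).mono (by omega) le_rfl
    · exact hB _ h
    · have := (ih h.2).lengthen
      rwa [Nat.sub_add_cancel h.1] at this

/-- The moments `t = 1, 2` force no words of weight `9` or `10` and exactly `55` of weight `8`,
which is not a multiple of three. -/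
lemma excluded_11_3_8 : Excluded 11 3 8 := by
  intro n C S hS hC hk
  by_contra! hd
  have e := fun t ht hex => sum_weightCount_mul_choose hS hC hk hd t ht
    (excluded_of_exclude (B := []) (by simp) hex)
  have z := fun w h0 hw => weightCount_eq_zero (w := w) hd h0 hw
  have h0 := weightCount_zero C
  have h3 := fun w hw => three_dvd_weightCount C (w := w) hw
  generalize weightCount C = A at *
  have e1 := e 1 (by norm_num) (by decide)
  have e2 := e 2 (by norm_num) (by decide)
  have := h3 8 (by norm_num)
  simp [Finset.sum_range_succ, z, h0, Nat.choose] at e1 e2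
  omega

/-- The moments give `A 8 = 3 - 2 * A 9`, and `A 9` is a multiple of three. -/
lemma weightCount_nine_eq_zero {C : Submodule F4 (Fin n → F4)} {S : Finset (Fin n)}
    (hS : S.card = 9) (hC : ∀ c ∈ C, ∀ i ∉ S, c i = 0) (hk : Module.finrank F4 C = 2)
    (hd : ∀ c ∈ C, c ≠ 0 → 7 ≤ weight c) : weightCount C 9 = 0 := by
  have e := fun t ht hex => sum_weightCount_mul_choose hS hC hk hd t ht
    (excluded_of_exclude (B := []) (by simp) hex)
  have z := fun w h0 hw => weightCount_eq_zero (w := w) hd h0 hw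
  have h0 := weightCount_zero C
  have h3 := fun w hw => three_dvd_weightCount C (w := w) hw
  generalize weightCount C = A at *
  have e0 := e 0 (by norm_num) (by decide)
  have e1 := e 1 (by norm_num) (by decide)
  have := h3 9 (by norm_num)
  simp [Finset.sum_range_succ, z, h0, Nat.choose] at e0 e1
  omega

/-- The dimension of a shortening at one coordinate. -/
lemma finrank_shorten_singleton {C : Submodule F4 (Fin n → F4)} {S : Finset (Fin n)} {m k d : ℕ}
    (hS : S.card = m + 1) (hC : ∀ c ∈ C, ∀ i ∉ S, c i = 0) (hk : Module.finrank F4 C = k + 1)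
    (hd : ∀ c ∈ C, c ≠ 0 → d ≤ weight c) (hex : Excluded m (k + 1) d) {i : Fin n} (hi : i ∈ S) :
    Module.finrank F4 (shorten C {i}) = k := by
  have h1 := finrank_le_finrank_shorten C {i}
  rw [Finset.card_singleton] at h1
  by_contra hne
  obtain ⟨c, hc, h0, hw⟩ := hex.exists (C := shorten C {i}) (S := S \ {i})
    (by rw [Finset.sdiff_singleton_eq_erase, Finset.card_erase_of_mem hi]; omega)
    (shorten_support hC {i}) (by omega)
  have := hd c hc.1 h0
  omega

/-- A word of weight nine would survive in some `[9, 2]` shortening, which has none. With `A 9 = 0`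
the moments give `A 7 = 40`, not a multiple of three. -/
lemma excluded_10_3_7 : Excluded 10 3 7 := by
  intro n C S hS hC hk
  by_contra! hd
  have e := fun t ht hex => sum_weightCount_mul_choose hS hC hk hd t ht
    (excluded_of_exclude (B := []) (by simp) hex)
  have h9 := sum_weightCount_shorten hC 9
  rw [Finset.sum_eq_zero, hS] at h9
  · have z := fun w h0 hw => weightCount_eq_zero (w := w) hd h0 hw
    have h0 := weightCount_zero C
    have h3 := fun w hw => three_dvd_weightCount C (w := w) hw
    generalize weightCount C = A at *
    have e0 := e 0 (by norm_num) (by decide)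
    have e1 := e 1 (by norm_num) (by decide)
    have e2 := e 2 (by norm_num) (by decide)
    have := h3 7 (by norm_num)
    simp [Finset.sum_range_succ, z, h0, Nat.choose] at e0 e1 e2
    omega
  · intro i hi
    refine weightCount_nine_eq_zero (S := S \ {i})
      (by rw [Finset.sdiff_singleton_eq_erase, Finset.card_erase_of_mem hi, hS])
      (shorten_support hC {i}) ?_ (fun c hc => hd c hc.1)
    exact finrank_shorten_singleton (m := 9) hS hC hk hd
      (excluded_of_exclude (B := []) (by simp) (by decide)) hi

/-- Such a code would be MDS, and its `[6, 2]` dual of distance at least five would violate the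
Plotkin bound. The `(7, 4, 4)` case below is analogous, after shortening the dual. -/
lemma excluded_6_4_3 : Excluded 6 4 3 :=
  Excluded.of_dual (e := 4) (excluded_of_exclude (B := []) (by simp) (by decide)) (by norm_num)
    le_rfl fun t ht => excluded_of_exclude (B := []) (by simp) (by interval_cases t <;> decide)

lemma excluded_7_4_4 : Excluded 7 4 4 :=
  Excluded.of_dual (e := 4) (excluded_of_exclude (B := []) (by simp) (by decide)) (by norm_num)
    le_rfl fun t ht => excluded_of_exclude (B := []) (by simp) (by interval_cases t <;> decide)

/-- The dual would be a `[12, 5]` code of distance at least seven, which shortens twice to the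
excluded `(10, 3, 7)`. -/
lemma excluded_12_7_5 : Excluded 12 7 5 :=
  Excluded.of_dual (e := 6) (excluded_of_exclude (B := [(10, 3, 7)])
      (by simpa using excluded_10_3_7) (by decide)) (by norm_num) (by norm_num)
    fun t ht => excluded_of_exclude (B := []) (by simp) (by interval_cases t <;> decide)

lemma excluded_of_sporadic {m k d : ℕ} (h : exclude sporadic m k d = true) : Excluded m k d :=
  excluded_of_exclude (B := sporadic) (by
    simpa [sporadic] using ⟨excluded_11_3_8, excluded_10_3_7, excluded_6_4_3, excluded_7_4_4,
      excluded_12_7_5⟩) h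

/-! ### The Hermitian form and the signed word count -/

lemma hermInner_add_left (u v w : Fin n → F4) :
    hermInner (u + v) w = hermInner u w + hermInner v w := by
  simp [hermInner, add_mul, Finset.sum_add_distrib]

lemma hermInner_smul_left (a : F4) (u v : Fin n → F4) :
    hermInner (a • u) v = a * hermInner u v := by
  simp [hermInner, Finset.mul_sum, mul_assoc]

lemma hermInner_comm (u v : Fin n → F4) : hermInner v u = hermInner u v ^ 2 := by
  rw [hermInner, hermInner, sum_pow_char]
  refine Finset.sum_congr rfl fun i _ => ?_
  rw [mul_pow, ← pow_mul, F4_pow_four, mul_comm]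

lemma hermInner_comm_eq_zero {u v : Fin n → F4} (h : hermInner u v = 0) : hermInner v u = 0 := by
  rw [hermInner_comm, h, zero_pow two_ne_zero]

lemma hermInner_add_right (u v w : Fin n → F4) :
    hermInner u (v + w) = hermInner u v + hermInner u w := by
  rw [hermInner_comm _ u, hermInner_add_left, F4_add_sq, ← hermInner_comm, ← hermInner_comm]

lemma mem_hermDual {C : Submodule F4 (Fin n → F4)} {v : Fin n → F4} :
    v ∈ hermDual C ↔ ∀ u ∈ C, hermInner u v = 0 := Iff.rfl

/-- Each nonzero coordinate contributes `x * x ^ 2 = 1`. -/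
lemma hermInner_self (c : Fin n → F4) : hermInner c c = (weight c : F4) := by
  rw [weight_eq, Finset.natCast_card_filter, hermInner]
  refine Finset.sum_congr rfl fun i _ => ?_
  by_cases h : c i = 0
  · simp [h]
  · rw [if_pos h, ← F4_pow_three h]
    ring

lemma natCast_F4_eq_zero_iff (w : ℕ) : (w : F4) = 0 ↔ Even w := by
  rw [CharP.cast_eq_zero_iff F4 2, even_iff_two_dvd]

lemma natCast_F4 (w : ℕ) : (w : F4) = 0 ∨ (w : F4) = 1 := by
  rcases Nat.even_or_odd w with h | h
  · exact Or.inl ((natCast_F4_eq_zero_iff w).2 h)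
  · right
    obtain ⟨j, rfl⟩ := h
    push_cast
    rw [F4_two]
    ring

/-- The sign of an element of the prime field. -/
noncomputable def sign (x : F4) : ℤ := if x = 0 then 1 else -1

lemma neg_one_pow_eq_sign (w : ℕ) : (-1 : ℤ) ^ w = sign w := by
  rw [sign]
  split_ifs with h
  · exact ((natCast_F4_eq_zero_iff w).1 h).neg_one_pow
  · rw [natCast_F4_eq_zero_iff, Nat.not_even_iff_odd] at h
    exact h.neg_one_pow

lemma F4_one_add_one : (1 : F4) + 1 = 0 := by
  rw [one_add_one_eq_two, F4_two]

lemma sign_add {x y : F4} (hx : x = 0 ∨ x = 1) (hy : y = 0 ∨ y = 1) :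
    sign (x + y) = sign x * sign y := by
  rcases hx with rfl | rfl <;> rcases hy with rfl | rfl <;>
    simp [sign, F4_one_add_one]

/-- The absolute trace. -/
noncomputable def tr (x : F4) : F4 := x + x ^ 2

lemma tr_eq (x : F4) : tr x = 0 ∨ tr x = 1 := by
  have h : tr x * (tr x - 1) = 0 := by
    rw [tr]
    linear_combination F4_pow_four x + x ^ 3 * F4_two
  rcases mul_eq_zero.1 h with h | h
  · exact Or.inl h
  · exact Or.inr (sub_eq_zero.1 h)

lemma tr_add (x y : F4) : tr (x + y) = tr x + tr y := by
  rw [tr, tr, tr, F4_add_sq]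
  ring

lemma tr_ω : tr ω = 1 := by
  rw [tr, ω_sq]
  linear_combination ω * F4_two

/-- Weight modulo two is a quadratic form over the prime field whose polar form is the trace of the
Hermitian form. -/
lemma neg_one_pow_weight_add (c e : Fin n → F4) :
    (-1 : ℤ) ^ weight (c + e) = (-1) ^ weight c * (-1) ^ weight e * sign (tr (hermInner c e)) := by
  simp only [neg_one_pow_eq_sign]
  have h : (weight (c + e) : F4) = weight c + weight e + tr (hermInner c e) := by
    rw [← hermInner_self, ← hermInner_self, ← hermInner_self, hermInner_add_left,
      hermInner_add_right, hermInner_add_right, hermInner_comm c e, tr]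
    ring
  have h2 : (weight c : F4) + weight e = 0 ∨ (weight c : F4) + weight e = 1 := by
    rw [← Nat.cast_add]
    exact natCast_F4 _
  rw [h, sign_add h2 (tr_eq _), sign_add (natCast_F4 _) (natCast_F4 _)]

/-- The signed word count `∑ (-1) ^ weight c`. -/
noncomputable def signedCount (C : Submodule F4 (Fin n → F4)) : ℤ :=
  ∑ c ∈ words C, (-1) ^ weight c

lemma sum_words_add {C : Submodule F4 (Fin n → F4)} {c : Fin n → F4} (hc : c ∈ C)
    (f : (Fin n → F4) → ℤ) : ∑ e ∈ words C, f (c + e) = ∑ e ∈ words C, f e := by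
  refine Finset.sum_nbij' (fun e => c + e) (fun e => e - c) ?_ ?_ ?_ ?_ ?_
  · exact fun e he => mem_words.2 (C.add_mem hc (mem_words.1 he))
  · exact fun e he => mem_words.2 (C.sub_mem (mem_words.1 he) hc)
  · exact fun e _ => add_sub_cancel_left c e
  · exact fun e _ => add_sub_cancel c e
  · exact fun e _ => rfl

lemma sum_sign_tr_hermInner (C : Submodule F4 (Fin n → F4)) (e : Fin n → F4) :
    ∑ c ∈ words C, sign (tr (hermInner c e)) = if e ∈ hermDual C then ((words C).card : ℤ) else 0 := by
  split_ifs with h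
  · rw [Finset.sum_congr rfl (g := fun _ => (1 : ℤ))]
    · simp
    · intro c hc
      rw [h c (mem_words.1 hc)]
      simp [tr, sign]
  · rw [mem_hermDual] at h
    push Not at h
    obtain ⟨u, hu, hne⟩ := h
    -- This multiple of `u` has product `ω` with `e`, of trace one; translating by it negates every
    -- term, so the sum vanishes.
    have hu' := C.smul_mem (ω * (hermInner u e)⁻¹) hu
    have h1 := sum_words_add hu' (fun c => sign (tr (hermInner c e)))
    have h2 : tr (hermInner ((ω * (hermInner u e)⁻¹) • u) e) = 1 := by
      rw [hermInner_smul_left, mul_assoc, inv_mul_cancel₀ hne, mul_one, tr_ω]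
    simp only [hermInner_add_left, tr_add] at h1
    rw [Finset.sum_congr rfl (g := fun c => -sign (tr (hermInner c e))), Finset.sum_neg_distrib]
      at h1
    · linarith
    · intro c _
      rw [sign_add (tr_eq _) (tr_eq _), h2, show sign 1 = -1 by simp [sign], neg_one_mul]

/-- The usual Gauss sum computation: write the second word as `c + e` and sum over `c` first. Only
`e` in the hull survives, and hull words have even weight. -/
lemma signedCount_sq (C : Submodule F4 (Fin n → F4)) :
    signedCount C ^ 2 = 4 ^ (Module.finrank F4 C + Module.finrank F4 (hermHull C)) := by
  have h1 : signedCount C ^ 2 =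
      ∑ e ∈ words C, (-1) ^ weight e * ∑ c ∈ words C, sign (tr (hermInner c e)) := by
    simp only [Finset.mul_sum]
    rw [Finset.sum_comm, sq]
    nth_rewrite 1 [signedCount]
    rw [Finset.sum_mul]
    refine Finset.sum_congr rfl fun c hc => ?_
    rw [signedCount, ← sum_words_add (mem_words.1 hc), Finset.mul_sum]
    refine Finset.sum_congr rfl fun e _ => ?_
    rw [neg_one_pow_weight_add, ← mul_assoc, ← mul_assoc, ← mul_pow]
    norm_num
  rw [h1]
  simp only [sum_sign_tr_hermInner, mul_ite, mul_zero]
  rw [← Finset.sum_filter]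
  have h2 : (words C).filter (· ∈ hermDual C) = words (hermHull C) := by
    ext c
    simp [hermHull]
  rw [h2, Finset.sum_congr rfl (g := fun _ => ((words C).card : ℤ))]
  · rw [Finset.sum_const, card_words, card_words, nsmul_eq_mul]
    push_cast
    ring
  · intro c hc
    have h3 : hermInner c c = 0 := (mem_words.1 hc).2 c (mem_words.1 hc).1
    rw [hermInner_self, natCast_F4_eq_zero_iff] at h3
    rw [h3.neg_one_pow, one_mul]

lemma signedCount_eq_sum_weightCount {C : Submodule F4 (Fin n → F4)} {m : ℕ}
    (hm : ∀ c ∈ C, weight c ≤ m) :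
    signedCount C = ∑ w ∈ Finset.range (m + 1), (weightCount C w : ℤ) * (-1) ^ w :=
  sum_words_eq_sum_weightCount hm fun w => (-1 : ℤ) ^ w

lemma three_dvd_signedCount_sub_one (C : Submodule F4 (Fin n → F4)) :
    (3 : ℤ) ∣ signedCount C - 1 := by
  rw [signedCount_eq_sum_weightCount (fun c _ => weight_le c), Finset.sum_range_succ',
    weightCount_zero]
  simp only [Nat.cast_one, pow_zero, mul_one, add_sub_cancel_right]
  refine Finset.dvd_sum fun w _ => Dvd.dvd.mul_right ?_ _
  exact_mod_cast three_dvd_weightCount C (Nat.succ_ne_zero w)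

/-- The hull dimension determines the signed word count. -/
lemma signedCount_eq (C : Submodule F4 (Fin n → F4)) :
    signedCount C = (-2) ^ (Module.finrank F4 C + Module.finrank F4 (hermHull C)) := by
  set j := Module.finrank F4 C + Module.finrank F4 (hermHull C) with hj
  have h1 : signedCount C ^ 2 = ((-2) ^ j) ^ 2 := by
    rw [signedCount_sq, ← hj, ← pow_mul, mul_comm, pow_mul]
    norm_num
  rcases sq_eq_sq_iff_eq_or_eq_neg.1 h1 with h | h
  · exact h
  · exfalso
    have h3 := three_dvd_signedCount_sub_one C
    have h4 : (3 : ℤ) ∣ (-2) ^ j - 1 := by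
      have := sub_dvd_pow_sub_pow (-2 : ℤ) 1 j
      rw [one_pow] at this
      exact (by norm_num : (3 : ℤ) ∣ -2 - 1).trans this
    rw [h] at h3
    omega

lemma signedCount_moment {C : Submodule F4 (Fin n → F4)} {S : Finset (Fin n)} {m k l : ℕ}
    (hS : S.card = m) (hC : ∀ c ∈ C, ∀ i ∉ S, c i = 0) (hk : Module.finrank F4 C = k)
    (hl : Module.finrank F4 (hermHull C) = l) :
    ∑ w ∈ Finset.range (m + 1), (weightCount C w : ℤ) * (-1) ^ w = (-2) ^ (k + l) := by
  rw [← signedCount_eq_sum_weightCount fun c hc => hS ▸ weight_le_card (hC c hc), signedCount_eq,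
    hk, hl]

/-- The constraints on the weight distribution of a code with known hull dimension. -/
lemma weight_moments {C : Submodule F4 (Fin n → F4)} {S : Finset (Fin n)} {m k l d : ℕ}
    (hS : S.card = m) (hC : ∀ c ∈ C, ∀ i ∉ S, c i = 0) (hk : Module.finrank F4 C = k)
    (hl : Module.finrank F4 (hermHull C) = l) (hd : ∀ c ∈ C, c ≠ 0 → d ≤ weight c) :
    weightCount C 0 = 1 ∧ (∀ w, 0 < w → w < d → weightCount C w = 0) ∧
    (∀ t ≤ k, exclude sporadic (m - t) (k - t + 1) d = true →
      ∑ w ∈ Finset.range (m + 1), weightCount C w * (m - w).choose t = m.choose t * 4 ^ (k - t)) ∧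
    ∑ w ∈ Finset.range (m + 1), (weightCount C w : ℤ) * (-1) ^ w = (-2) ^ (k + l) :=
  ⟨weightCount_zero C, fun _ h0 hw => weightCount_eq_zero hd h0 hw,
    fun t ht hex => sum_weightCount_mul_choose hS hC hk hd t ht (excluded_of_sporadic hex),
    signedCount_moment hS hC hk hl⟩

/-! ### Weight distributions incompatible with a one-dimensional hull -/

/-- No sequence satisfies the constraints on the weight distribution of a code with the given
parameters and one-dimensional hull. -/
def NoWeightDistribution (m k d : ℕ) : Prop :=
  ∀ A : ℕ → ℕ, A 0 = 1 → (∀ w, 0 < w → w < d → A w = 0) →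
    (∀ t ≤ k, exclude sporadic (m - t) (k - t + 1) d = true →
      ∑ w ∈ Finset.range (m + 1), A w * (m - w).choose t = m.choose t * 4 ^ (k - t)) →
    ∑ w ∈ Finset.range (m + 1), (A w : ℤ) * (-1) ^ w ≠ (-2) ^ (k + 1)

lemma NoWeightDistribution.exists {k d : ℕ} (h : NoWeightDistribution n k d)
    {C : Submodule F4 (Fin n → F4)} (hk : Module.finrank F4 C = k)
    (hl : Module.finrank F4 (hermHull C) = 1) : ∃ c ∈ C, c ≠ 0 ∧ weight c < d := by
  by_contra! hd
  obtain ⟨h0, hz, he, hs⟩ := weight_moments (S := Finset.univ) (m := n) (by simp) (by simp) hk hl hd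
  exact h _ h0 hz he hs

lemma noWeightDistribution_one {m : ℕ} (hm : m ∈ [3, 5, 7, 9, 11]) :
    NoWeightDistribution m 1 m := by
  intro A h0 hz he hs
  fin_cases hm <;> simp [Finset.sum_range_succ, h0, hz] at hs <;> omega

/-- For odd `n`, `k = n - 1` and `d = 2`, the moments `t < k` determine the distribution, and its
signed sum is `(-2) ^ k`, the value for a trivial hull. -/
lemma noWeightDistribution_3_2 : NoWeightDistribution 3 2 2 := by
  intro A h0 hz he hs
  have e0 := he 0 (by norm_num) (by decide)
  have e1 := he 1 (by norm_num) (by decide)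
  simp [Finset.sum_range_succ, h0, hz, Nat.choose] at hs e0 e1
  omega

lemma noWeightDistribution_5_4 : NoWeightDistribution 5 4 2 := by
  intro A h0 hz he hs
  have e0 := he 0 (by norm_num) (by decide)
  have e1 := he 1 (by norm_num) (by decide)
  have e2 := he 2 (by norm_num) (by decide)
  have e3 := he 3 (by norm_num) (by decide)
  simp [Finset.sum_range_succ, h0, hz, Nat.choose] at hs e0 e1 e2 e3
  omega

lemma noWeightDistribution_7_6 : NoWeightDistribution 7 6 2 := by
  intro A h0 hz he hs
  have e0 := he 0 (by norm_num) (by decide)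
  have e1 := he 1 (by norm_num) (by decide)
  have e2 := he 2 (by norm_num) (by decide)
  have e3 := he 3 (by norm_num) (by decide)
  have e4 := he 4 (by norm_num) (by decide)
  have e5 := he 5 (by norm_num) (by decide)
  simp [Finset.sum_range_succ, h0, hz, Nat.choose] at hs e0 e1 e2 e3 e4 e5
  omega

lemma noWeightDistribution_9_8 : NoWeightDistribution 9 8 2 := by
  intro A h0 hz he hs
  have e0 := he 0 (by norm_num) (by decide)
  have e1 := he 1 (by norm_num) (by decide)
  have e2 := he 2 (by norm_num) (by decide)
  have e3 := he 3 (by norm_num) (by decide)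
  have e4 := he 4 (by norm_num) (by decide)
  have e5 := he 5 (by norm_num) (by decide)
  have e6 := he 6 (by norm_num) (by decide)
  have e7 := he 7 (by norm_num) (by decide)
  simp [Finset.sum_range_succ, h0, hz, Nat.choose] at hs e0 e1 e2 e3 e4 e5 e6 e7
  omega

lemma noWeightDistribution_11_10 : NoWeightDistribution 11 10 2 := by
  intro A h0 hz he hs
  have e0 := he 0 (by norm_num) (by decide)
  have e1 := he 1 (by norm_num) (by decide)
  have e2 := he 2 (by norm_num) (by decide)
  have e3 := he 3 (by norm_num) (by decide)
  have e4 := he 4 (by norm_num) (by decide)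
  have e5 := he 5 (by norm_num) (by decide)
  have e6 := he 6 (by norm_num) (by decide)
  have e7 := he 7 (by norm_num) (by decide)
  have e8 := he 8 (by norm_num) (by decide)
  have e9 := he 9 (by norm_num) (by decide)
  simp [Finset.sum_range_succ, h0, hz, Nat.choose] at hs e0 e1 e2 e3 e4 e5 e6 e7 e8 e9
  omega

lemma noWeightDistribution_5_2 : NoWeightDistribution 5 2 4 := by
  intro A h0 hz he hs
  have e1 := he 1 (by norm_num) (by decide)
  have e0 := he 0 (by norm_num) (by decide)
  simp [Finset.sum_range_succ, h0, hz, Nat.choose] at hs e0 e1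
  omega

lemma noWeightDistribution_5_3 : NoWeightDistribution 5 3 3 := by
  intro A h0 hz he hs
  have e0 := he 0 (by norm_num) (by decide)
  have e1 := he 1 (by norm_num) (by decide)
  have e2 := he 2 (by norm_num) (by decide)
  simp [Finset.sum_range_succ, h0, hz, Nat.choose] at hs e0 e1 e2
  omega

lemma noWeightDistribution_6_3 : NoWeightDistribution 6 3 4 := by
  intro A h0 hz he hs
  have e0 := he 0 (by norm_num) (by decide)
  have e1 := he 1 (by norm_num) (by decide)
  have e2 := he 2 (by norm_num) (by decide)
  simp [Finset.sum_range_succ, h0, hz, Nat.choose] at hs e0 e1 e2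
  omega

/-- The equations would force `A 7 = 12`, `A 6 = 6` and `A 8 = -3`. The next case similarly forces
`A 10 = -6`. -/
lemma noWeightDistribution_8_2 : NoWeightDistribution 8 2 6 := by
  intro A h0 hz he hs
  have e0 := he 0 (by norm_num) (by decide)
  have e1 := he 1 (by norm_num) (by decide)
  simp [Finset.sum_range_succ, h0, hz, Nat.choose] at hs e0 e1
  omega

lemma noWeightDistribution_10_2 : NoWeightDistribution 10 2 8 := by
  intro A h0 hz he hs
  have e0 := he 0 (by norm_num) (by decide)
  have e1 := he 1 (by norm_num) (by decide)
  simp [Finset.sum_range_succ, h0, hz, Nat.choose] at hs e0 e1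
  omega

/-! ### Hulls of shortenings, and the parameters `[10, 4, 6]` and `[11, 5, 6]` -/

lemma exists_hermHull_eq_span {C : Submodule F4 (Fin n → F4)}
    (hl : Module.finrank F4 (hermHull C) = 1) :
    ∃ h : Fin n → F4, h ≠ 0 ∧ hermHull C = Submodule.span F4 {h} := by
  obtain ⟨⟨h, hh⟩, h0, hspan⟩ := finrank_eq_one_iff'.1 hl
  refine ⟨h, fun h' => h0 (Subtype.ext h'), le_antisymm ?_ ?_⟩
  · intro v hv
    obtain ⟨a, ha⟩ := hspan ⟨v, hv⟩
    exact Submodule.mem_span_singleton.2 ⟨a, congrArg Subtype.val ha⟩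
  · rwa [Submodule.span_singleton_le_iff_mem]

/-- Here `C` is the shortening plus the line of `h`, and `h` is orthogonal to `C`. A hull word of
the shortening is thus in the hull of `C`, hence a multiple of `h` vanishing at `i`. -/
lemma finrank_hermHull_shorten_of_ne_zero {C : Submodule F4 (Fin n → F4)} {h : Fin n → F4}
    (hh : hermHull C = Submodule.span F4 {h}) {i : Fin n} (hi : h i ≠ 0) :
    Module.finrank F4 (hermHull (shorten C {i})) = 0 := by
  have hmem : h ∈ hermHull C := hh ▸ Submodule.mem_span_singleton_self h
  suffices hermHull (shorten C {i}) = ⊥ by rw [this, finrank_bot]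
  rw [eq_bot_iff]
  intro v hv
  have hvC : v ∈ hermHull C := by
    refine ⟨hv.1.1, fun u hu => ?_⟩
    have hu' : u - (u i / h i) • h ∈ shorten C {i} := by
      refine ⟨C.sub_mem hu (C.smul_mem _ hmem.1), fun j hj => ?_⟩
      rw [Finset.mem_singleton] at hj
      subst hj
      simp [div_mul_cancel₀ _ hi]
    have h1 := hv.2 _ hu'
    have h2 : hermInner h v = 0 := hermInner_comm_eq_zero (hmem.2 v hv.1.1)
    rw [sub_eq_add_neg, ← neg_smul, hermInner_add_left, hermInner_smul_left, h2, mul_zero,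
      add_zero] at h1
    exact h1
  rw [hh, Submodule.mem_span_singleton] at hvC
  obtain ⟨a, rfl⟩ := hvC
  have h3 := hv.1.2 i (Finset.mem_singleton_self i)
  simp only [Pi.smul_apply, smul_eq_mul, mul_eq_zero, hi, or_false] at h3
  simp [h3]

/-- The shortening and one word `v₀` with `v₀ i ≠ 0` generate `C`, so orthogonality to `v₀` is the
only extra condition for lying in the hull of `C`. -/
lemma finrank_hermHull_shorten_le (C : Submodule F4 (Fin n → F4)) (i : Fin n) :
    Module.finrank F4 (hermHull (shorten C {i})) ≤ Module.finrank F4 (hermHull C) + 1 := by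
  by_cases hz : ∀ c ∈ C, c i = 0
  · have : shorten C {i} = C :=
      le_antisymm (shorten_le C _) fun c hc => ⟨hc, fun j hj => by
        rw [Finset.mem_singleton] at hj
        rw [hj, hz c hc]⟩
    rw [this]
    omega
  push Not at hz
  obtain ⟨v₀, hv₀, hne⟩ := hz
  let f : hermHull (shorten C {i}) →ₗ[F4] F4 :=
    { toFun := fun v => hermInner v.1 v₀
      map_add' := fun a b => hermInner_add_left a.1 b.1 v₀
      map_smul' := fun a b => hermInner_smul_left a b.1 v₀ }
  have h := finrank_le_of_ker (D := hermHull C) f (by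
    intro v hv
    refine ⟨v.2.1.1, fun u hu => ?_⟩
    have hu' : u - (u i / v₀ i) • v₀ ∈ shorten C {i} := by
      refine ⟨C.sub_mem hu (C.smul_mem _ hv₀), fun j hj => ?_⟩
      rw [Finset.mem_singleton] at hj
      subst hj
      simp [div_mul_cancel₀ _ hne]
    have h1 := v.2.2 _ hu'
    have h2 : hermInner v₀ v.1 = 0 := hermInner_comm_eq_zero hv
    rw [sub_eq_add_neg, ← neg_smul, hermInner_add_left, hermInner_smul_left, h2, mul_zero,
      add_zero] at h1
    exact h1)
  simpa using h

lemma one_le_finrank_hermHull_shorten {C : Submodule F4 (Fin n → F4)} {h : Fin n → F4}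
    (hmem : h ∈ hermHull C) (h0 : h ≠ 0) {i : Fin n} (hi : h i = 0) :
    1 ≤ Module.finrank F4 (hermHull (shorten C {i})) := by
  rw [Nat.one_le_iff_ne_zero, Ne, Submodule.finrank_eq_zero]
  intro hbot
  have hm : h ∈ hermHull (shorten C {i}) := by
    refine ⟨⟨hmem.1, fun j hj => ?_⟩, fun u hu => hmem.2 u hu.1⟩
    rw [Finset.mem_singleton] at hj
    rw [hj, hi]
  rw [hbot, Submodule.mem_bot] at hm
  exact h0 hm

lemma sum_ite_eq_zero {c : Fin n → F4} {S : Finset (Fin n)} (hc : ∀ i ∉ S, c i = 0) (a b : ℕ) :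
    ∑ i ∈ S, (if c i = 0 then a else b) = a * (S.card - weight c) + b * weight c := by
  rw [Finset.sum_ite, Finset.sum_const, Finset.sum_const, card_filter_eq_zero hc, smul_eq_mul,
    smul_eq_mul]
  have h := Finset.card_filter_add_card_filter_not (s := S) (fun i => c i = 0)
  rw [card_filter_eq_zero hc] at h
  have h2 := weight_le_card hc
  rw [show (S.filter fun i => ¬ c i = 0).card = weight c by omega, mul_comm, mul_comm b]

/-- The moments leave `A 6` free with `A 9 = 36 - A 6`, and the signed sum fixes `A 6`. For `l = 2`
it would make `A 8` negative, so that case is vacuous. -/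
lemma weightCount_nine {C : Submodule F4 (Fin n → F4)} {S : Finset (Fin n)} {l : ℕ}
    (hS : S.card = 9) (hC : ∀ c ∈ C, ∀ i ∉ S, c i = 0) (hk : Module.finrank F4 C = 3)
    (hl : Module.finrank F4 (hermHull C) = l) (hd : ∀ c ∈ C, c ≠ 0 → 6 ≤ weight c) (hl2 : l ≤ 2) :
    weightCount C 9 = if l = 0 then 9 else 6 := by
  obtain ⟨h0, hz, he, hs⟩ := weight_moments hS hC hk hl hd
  generalize weightCount C = A at *
  have e0 := he 0 (by norm_num) (by decide)
  have e1 := he 1 (by norm_num) (by decide)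
  have e2 := he 2 (by norm_num) (by decide)
  clear hl
  interval_cases l <;>
  · simp [Finset.sum_range_succ, h0, hz, Nat.choose] at hs e0 e1 e2 ⊢
    omega

lemma card_sdiff_singleton {S : Finset (Fin n)} {i : Fin n} {m : ℕ} (hS : S.card = m + 1)
    (hi : i ∈ S) : (S \ {i}).card = m := by
  rw [Finset.sdiff_singleton_eq_erase, Finset.card_erase_of_mem hi, hS, Nat.add_sub_cancel]

/-- Summing over the shortenings gives `A 9 = 60 + 3 * weight h`, while the moments and the signed
sum give `A 9 = 72`. Then `h` has weight four, below the minimum distance. -/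
lemma finrank_hermHull_ne_one_of_10_4_6 {C : Submodule F4 (Fin n → F4)} {S : Finset (Fin n)}
    (hS : S.card = 10) (hC : ∀ c ∈ C, ∀ i ∉ S, c i = 0) (hk : Module.finrank F4 C = 4)
    (hd : ∀ c ∈ C, c ≠ 0 → 6 ≤ weight c) : Module.finrank F4 (hermHull C) ≠ 1 := by
  intro hl
  obtain ⟨h, hne, hh⟩ := exists_hermHull_eq_span hl
  have hmem : h ∈ hermHull C := hh ▸ Submodule.mem_span_singleton_self h
  have h1 : ∀ i ∈ S, weightCount (shorten C {i}) 9 = if h i = 0 then 6 else 9 := by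
    intro i hi
    have hdim := finrank_shorten_singleton (m := 9) hS hC hk hd
      (excluded_of_sporadic (by decide)) hi
    have hle := finrank_hermHull_shorten_le C i
    rw [weightCount_nine (card_sdiff_singleton hS hi) (shorten_support hC {i}) hdim rfl
      (fun c hc => hd c hc.1) (by omega)]
    by_cases hi0 : h i = 0
    · have := one_le_finrank_hermHull_shorten hmem hne hi0
      rw [if_neg (by omega), if_pos hi0]
    · rw [if_pos (finrank_hermHull_shorten_of_ne_zero hh hi0), if_neg hi0]
  have h2 := sum_weightCount_shorten hC 9
  rw [Finset.sum_congr rfl h1, sum_ite_eq_zero (hC h hmem.1), hS] at h2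
  have h3 := hd h hmem.1 hne
  have h4 := weight_le_card (hC h hmem.1)
  obtain ⟨h0, hz, he, hs⟩ := weight_moments hS hC hk hl hd
  generalize weightCount C = A at *
  have e0 := he 0 (by norm_num) (by decide)
  have e1 := he 1 (by norm_num) (by decide)
  have e2 := he 2 (by norm_num) (by decide)
  have e3 := he 3 (by norm_num) (by decide)
  simp [Finset.sum_range_succ, h0, hz, Nat.choose] at hs e0 e1 e2 e3
  omega

lemma weightCount_ten {C : Submodule F4 (Fin n → F4)} {S : Finset (Fin n)} {l : ℕ}
    (hS : S.card = 10) (hC : ∀ c ∈ C, ∀ i ∉ S, c i = 0) (hk : Module.finrank F4 C = 4)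
    (hl : Module.finrank F4 (hermHull C) = l) (hd : ∀ c ∈ C, c ≠ 0 → 6 ≤ weight c)
    (hl2 : l = 0 ∨ l = 2) :
    weightCount C 10 = if l = 0 then 15 else 18 := by
  obtain ⟨h0, hz, he, hs⟩ := weight_moments hS hC hk hl hd
  generalize weightCount C = A at *
  have e0 := he 0 (by norm_num) (by decide)
  have e1 := he 1 (by norm_num) (by decide)
  have e2 := he 2 (by norm_num) (by decide)
  have e3 := he 3 (by norm_num) (by decide)
  clear hl
  rcases hl2 with rfl | rfl <;>
  · simp [Finset.sum_range_succ, h0, hz, Nat.choose] at hs e0 e1 e2 e3 ⊢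
    omega

/-- In an `[11, 5, 6]` code with one-dimensional hull the hull is spanned by a word of weight
six. -/
lemma weight_eq_six_of_11_5_6 {C : Submodule F4 (Fin n → F4)} {S : Finset (Fin n)}
    (hS : S.card = 11) (hC : ∀ c ∈ C, ∀ i ∉ S, c i = 0) (hk : Module.finrank F4 C = 5)
    (hd : ∀ c ∈ C, c ≠ 0 → 6 ≤ weight c) {h : Fin n → F4} (hne : h ≠ 0)
    (hh : hermHull C = Submodule.span F4 {h}) : weight h = 6 := by
  have hmem : h ∈ hermHull C := hh ▸ Submodule.mem_span_singleton_self h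
  have hl : Module.finrank F4 (hermHull C) = 1 := by rw [hh, finrank_span_singleton hne]
  have h1 : ∀ i ∈ S, weightCount (shorten C {i}) 10 = if h i = 0 then 18 else 15 := by
    intro i hi
    have hdim := finrank_shorten_singleton (m := 10) hS hC hk hd
      (excluded_of_sporadic (by decide)) hi
    have hle := finrank_hermHull_shorten_le C i
    -- A shortening has hull dimension at most two and, by the previous case, not one; so it is `0`
    -- or `2` according to whether `h i` is nonzero.
    have hne1 := finrank_hermHull_ne_one_of_10_4_6 (card_sdiff_singleton hS hi)
      (shorten_support hC {i}) hdim (fun c hc => hd c hc.1)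
    rw [weightCount_ten (card_sdiff_singleton hS hi) (shorten_support hC {i}) hdim rfl
      (fun c hc => hd c hc.1) (by omega)]
    by_cases hi0 : h i = 0
    · have := one_le_finrank_hermHull_shorten hmem hne hi0
      rw [if_neg (by omega), if_pos hi0]
    · rw [if_pos (finrank_hermHull_shorten_of_ne_zero hh hi0), if_neg hi0]
  -- This gives `A 10 = 198 - 3 * weight h`, against `A 10 = 180` from the linear equations.
  have h2 := sum_weightCount_shorten hC 10
  rw [Finset.sum_congr rfl h1, sum_ite_eq_zero (hC h hmem.1), hS] at h2
  have h4 := weight_le_card (hC h hmem.1)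
  obtain ⟨h0, hz, he, hs⟩ := weight_moments hS hC hk hl hd
  generalize weightCount C = A at *
  have e0 := he 0 (by norm_num) (by decide)
  have e1 := he 1 (by norm_num) (by decide)
  have e2 := he 2 (by norm_num) (by decide)
  have e3 := he 3 (by norm_num) (by decide)
  have e4 := he 4 (by norm_num) (by decide)
  simp [Finset.sum_range_succ, h0, hz, Nat.choose] at hs e0 e1 e2 e3 e4
  omega

end

/-! ### Bit-mask arithmetic for the explicit codes -/

/-- The number of ones among the lowest `m` binary digits of `x`. -/
noncomputable def popCount (m : ℕ) : ℕ → ℕ :=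
  Nat.rec (fun _ => 0) (fun _ ih x => Nat.add (Nat.mod x 2) (ih (Nat.div x 2))) m

lemma popCount_succ (m x : ℕ) : popCount (m + 1) x = x % 2 + popCount m (x / 2) := rfl

/-- Multiplication by a scalar `s + t ω` in the coding of vectors by pairs of bit masks. -/
def scaleCode (s t : Bool) (r : ℕ × ℕ) : ℕ × ℕ :=
  match s, t with
  | false, false => (0, 0)
  | true, false => r
  | false, true => (r.2, r.1 ^^^ r.2)
  | true, true => (r.1 ^^^ r.2, r.1)

/-- The coordinates of the Hermitian product of two vectors coded by pairs of bit masks, each as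
an integer to be read modulo two. -/
noncomputable def hermCode (n : ℕ) (p q : ℕ × ℕ) : ℕ × ℕ :=
  (popCount n ((p.1 &&& q.1) ^^^ (p.2 &&& q.2) ^^^ (p.1 &&& q.2)),
    popCount n ((p.1 &&& q.2) ^^^ (p.2 &&& q.1)))

/-- All combinations of the rows with fewer than `d` nonzero coefficients, added to the vector
coded by `(a, b)`, have weight at least `d`; here `j` coefficients have been used already, and the
combination without any nonzero coefficient is ignored. -/
noncomputable def scan (n d : ℕ) : List (ℕ × ℕ) → ℕ → ℕ → ℕ → Bool
  | [], j, a, b => j == 0 || d.ble (popCount n (a ||| b))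
  | r :: rs, j, a, b => d.ble j || (scan n d rs j a b &&
      (scan n d rs (j + 1) (a ^^^ r.1) (b ^^^ r.2) &&
      (scan n d rs (j + 1) (a ^^^ r.2) (b ^^^ (r.1 ^^^ r.2)) &&
      scan n d rs (j + 1) (a ^^^ (r.1 ^^^ r.2)) (b ^^^ r.1))))

/-- The combination of the rows whose coefficients are the coordinates of `b` from the `o`-th on. -/
def combine (b : ℕ × ℕ) : List (ℕ × ℕ) → ℕ → ℕ × ℕ
  | [], _ => (0, 0)
  | r :: rs, o =>
    let s := scaleCode (b.1.testBit o) (b.2.testBit o) r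
    let t := combine b rs (o + 1)
    (s.1 ^^^ t.1, s.2 ^^^ t.2)

/-- The rows generate, in systematic form, a code of minimum distance at least `d`. -/
noncomputable def checkCode (n k d : ℕ) (rs : List (ℕ × ℕ)) : Bool :=
  decide (rs.length = k) && decide (k ≤ n) && scan n d rs 0 0 0 &&
    decide (∀ i : Fin rs.length, rs[i].1 % 2 ^ k = 2 ^ (i : ℕ) ∧ rs[i].2 % 2 ^ k = 0)

/-- The vector `h` and the vectors `fs` lie in the code generated by `rs`, the vector `h` is
isotropic and the `fs` are orthonormal and orthogonal to `h`. -/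
noncomputable def checkHull (n k : ℕ) (rs : List (ℕ × ℕ)) (h : ℕ × ℕ) (fs : List (ℕ × ℕ)) : Bool :=
  decide (fs.length + 1 = k) && decide (combine h rs 0 = h) &&
    fs.all (fun f => decide (combine f rs 0 = f)) && decide (popCount n (h.1 ||| h.2) ≠ 0) &&
    decide ((hermCode n h h).1 % 2 = 0 ∧ (hermCode n h h).2 % 2 = 0) &&
    decide (∀ i : Fin fs.length, (hermCode n fs[i] h).1 % 2 = 0 ∧ (hermCode n fs[i] h).2 % 2 = 0) &&
    decide (∀ i j : Fin fs.length, (hermCode n fs[i] fs[j]).1 % 2 = (if i = j then 1 else 0) ∧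
      (hermCode n fs[i] fs[j]).2 % 2 = 0)

section
open scoped Classical
variable {n : ℕ}

/-- A bit as an element of the field. -/
noncomputable def bit (b : Bool) : F4 := if b then 1 else 0

@[simp] lemma bit_true : bit true = 1 := rfl
@[simp] lemma bit_false : bit false = 0 := rfl

/-- The vector coded by a pair of bit masks. -/
noncomputable def decode (n : ℕ) (p : ℕ × ℕ) : Fin n → F4 :=
  fun i => bit (p.1.testBit i) + bit (p.2.testBit i) * ω

lemma bit_xor (a b : Bool) : bit (a ^^ b) = bit a + bit b := by
  cases a <;> cases b <;> simp [F4_one_add_one]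

lemma decode_xor (a b c d : ℕ) :
    decode n (a ^^^ c, b ^^^ d) = decode n (a, b) + decode n (c, d) := by
  funext i
  simp only [decode, Nat.testBit_xor, bit_xor, Pi.add_apply]
  ring

lemma decode_zero : decode n (0, 0) = 0 := by
  funext i
  simp [decode]

lemma decode_scaleCode (s t : Bool) (r : ℕ × ℕ) :
    decode n (scaleCode s t r) = (bit s + bit t * ω) • decode n r := by
  funext i
  cases s <;> cases t <;> simp only [scaleCode, decode, Nat.testBit_xor, bit_xor, Pi.smul_apply,
    smul_eq_mul, bit_true, bit_false, Nat.zero_testBit]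
  · ring
  · linear_combination -bit (r.2.testBit i) * ω_sq
  · ring
  · linear_combination -bit (r.2.testBit i) * ω_sq - bit (r.2.testBit i) * ω * F4_two

lemma popCount_eq_sum (m x : ℕ) :
    popCount m x = ∑ i : Fin m, if x.testBit i then 1 else 0 := by
  induction m generalizing x with
  | zero => simp [popCount]
  | succ m ih =>
    rw [popCount_succ, ih, Fin.sum_univ_succ]
    congr 1
    · simp only [Fin.val_zero, Nat.testBit_zero]
      rcases Nat.mod_two_eq_zero_or_one x with h | h <;> simp [h]
    · simp [Nat.testBit_succ]

lemma natCast_popCount (m x : ℕ) : (popCount m x : F4) = ∑ i : Fin m, bit (x.testBit i) := by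
  rw [popCount_eq_sum]
  push_cast
  refine Finset.sum_congr rfl fun i _ => ?_
  cases x.testBit i <;> simp

lemma bit_add_bit_mul_eq_zero {a b : Bool} :
    bit a + bit b * ω = 0 ↔ a = false ∧ b = false := by
  cases a <;> cases b <;> simp [ω_ne_zero, add_comm (1 : F4) ω, ω_add_one_ne_zero]

lemma weight_decode (p : ℕ × ℕ) : weight (decode n p) = popCount n (p.1 ||| p.2) := by
  rw [weight_eq, popCount_eq_sum, Finset.card_filter]
  refine Finset.sum_congr rfl fun i _ => ?_
  simp only [decode, Ne, bit_add_bit_mul_eq_zero, Nat.testBit_or]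
  cases p.1.testBit i <;> cases p.2.testBit i <;> simp

lemma bit_and (a b : Bool) : bit (a && b) = bit a * bit b := by
  cases a <;> cases b <;> simp

lemma bit_sq (a : Bool) : bit a ^ 2 = bit a := by
  cases a <;> simp

/-- Expand `(p₁ + p₂ ω) (q₁ + q₂ ω ^ 2)` with `ω ^ 2 = ω + 1` and `ω ^ 3 = 1`. -/
lemma hermInner_decode (p q : ℕ × ℕ) :
    hermInner (decode n p) (decode n q) =
      ((hermCode n p q).1 : F4) + ((hermCode n p q).2 : F4) * ω := by
  simp only [hermCode, natCast_popCount, hermInner, decode, Finset.sum_mul,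
    ← Finset.sum_add_distrib]
  refine Finset.sum_congr rfl fun i _ => ?_
  simp only [Nat.testBit_xor, Nat.testBit_and, bit_xor, bit_and]
  rw [F4_add_sq, mul_pow, bit_sq, bit_sq]
  linear_combination (bit (p.1.testBit i) * bit (q.2.testBit i) +
    bit (p.2.testBit i) * bit (q.2.testBit i) * (ω + 1)) * ω_sq +
    bit (p.2.testBit i) * bit (q.2.testBit i) * ω * F4_two

lemma natCast_F4_eq_mod (a : ℕ) : (a : F4) = ((a % 2 : ℕ) : F4) :=
  (CharP.natCast_eq_natCast_mod F4 2 a)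

lemma hermInner_decode_eq {p q : ℕ × ℕ} {e : ℕ} (h1 : (hermCode n p q).1 % 2 = e)
    (h2 : (hermCode n p q).2 % 2 = 0) : hermInner (decode n p) (decode n q) = e := by
  rw [hermInner_decode, natCast_F4_eq_mod, h1, natCast_F4_eq_mod (hermCode n p q).2, h2]
  simp

/-- The combination of the rows with the given coefficients. -/
noncomputable def encode (n : ℕ) (rs : List (ℕ × ℕ)) : (Fin rs.length → F4) →ₗ[F4] (Fin n → F4) :=
  Fintype.linearCombination F4 fun i => decode n rs[i]

lemma encode_apply (rs : List (ℕ × ℕ)) (g : Fin rs.length → F4) :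
    encode n rs g = ∑ i, g i • decode n rs[i] := Fintype.linearCombination_apply ..

lemma encode_cons (r : ℕ × ℕ) (rs : List (ℕ × ℕ)) (g : Fin (r :: rs).length → F4) :
    encode n (r :: rs) g = g 0 • decode n r + encode n rs (fun i => g i.succ) := by
  rw [encode_apply, encode_apply]
  exact Fin.sum_univ_succ (n := rs.length) (fun i => g i • decode n (r :: rs)[i])

lemma weight_succ {m : ℕ} (g : Fin (m + 1) → F4) :
    weight g = (if g 0 = 0 then 0 else 1) + weight (fun i => g i.succ) := by
  rw [weight_eq, weight_eq, Finset.card_filter, Finset.card_filter, Fin.sum_univ_succ]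
  simp only [Ne, ite_not]

/-- The middle alternative is the pruned branch: with `d` nonzero coefficients the systematic form
already gives weight `d`, see `weight_le_weight_encode`. -/
lemma of_scan {d : ℕ} {rs : List (ℕ × ℕ)} {j a b : ℕ} (h : scan n d rs j a b = true)
    (g : Fin rs.length → F4) :
    j + weight g = 0 ∨ d ≤ j + weight g ∨ d ≤ weight (decode n (a, b) + encode n rs g) := by
  induction rs generalizing j a b with
  | nil =>
    simp only [scan, Bool.or_eq_true, beq_iff_eq, Nat.ble_eq] at h
    have hg : weight g = 0 := weight_eq_zero.2 (funext fun i => Fin.elim0 i)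
    have he : encode n [] g = 0 := by rw [encode_apply]; rfl
    rw [hg, he, add_zero, add_zero, weight_decode]
    tauto
  | cons r rs ih =>
    simp only [scan, Bool.or_eq_true, Bool.and_eq_true, Nat.ble_eq] at h
    rcases h with h | ⟨h0, h1, h2, h3⟩
    · right; left; omega
    have key := F4_cases (g 0)
    have hw : weight g = (if g 0 = 0 then 0 else 1) + weight (fun i : Fin rs.length => g i.succ) :=
      weight_succ g
    have hs : ∀ s t : Bool, g 0 = bit s + bit t * ω →
        decode n (a, b) + encode n (r :: rs) g =
          decode n (a ^^^ (scaleCode s t r).1, b ^^^ (scaleCode s t r).2) +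
            encode n rs (fun i => g i.succ) := by
      intro s t hst
      rw [encode_cons, decode_xor, decode_scaleCode, hst, add_assoc]
    rcases key with hg | hg | hg | hg
    · rw [hw, hs false false (by simp [hg]), if_pos hg, zero_add]
      simpa [scaleCode] using ih h0 (fun i => g i.succ)
    · rw [hw, hs true false (by simp [hg]), if_neg (by simp [hg]), ← add_assoc]
      exact ih h1 (fun i => g i.succ)
    · rw [hw, hs false true (by simp [hg]), if_neg (by simp [hg, ω_ne_zero]), ← add_assoc]
      exact ih h2 (fun i => g i.succ)
    · rw [hw, hs true true (by simp [hg, add_comm]), if_neg (by simp [hg, ω_add_one_ne_zero]),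
        ← add_assoc]
      exact ih h3 (fun i => g i.succ)

lemma decode_combine (b : ℕ × ℕ) (rs : List (ℕ × ℕ)) (o : ℕ) :
    ∃ g, decode n (combine b rs o) = encode n rs g := by
  induction rs generalizing o with
  | nil => exact ⟨0, by rw [map_zero, combine, decode_zero]⟩
  | cons r rs ih =>
    obtain ⟨g, hg⟩ := ih (o + 1)
    refine ⟨Fin.cons (bit (b.1.testBit o) + bit (b.2.testBit o) * ω) g, ?_⟩
    rw [combine, decode_xor, encode_cons]
    exact congrArg₂ (· + ·) (decode_scaleCode _ _ _) hg

lemma encode_apply_castLE {k : ℕ} {rs : List (ℕ × ℕ)} (hlen : rs.length = k) (hk : k ≤ n)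
    (hsys : ∀ i : Fin rs.length, rs[i].1 % 2 ^ k = 2 ^ (i : ℕ) ∧ rs[i].2 % 2 ^ k = 0)
    (g : Fin rs.length → F4) (j : Fin rs.length) :
    encode n rs g (Fin.castLE (hlen ▸ hk) j) = g j := by
  have hdec : ∀ i : Fin rs.length,
      decode n rs[i] (Fin.castLE (hlen ▸ hk) j) = if i = j then 1 else 0 := by
    intro i
    have hj : (j : ℕ) < k := hlen ▸ j.2
    have h1 := congrArg (fun x => Nat.testBit x j) (hsys i).1
    have h2 := congrArg (fun x => Nat.testBit x j) (hsys i).2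
    simp only [Nat.testBit_mod_two_pow, hj, decide_true, Bool.true_and, Nat.testBit_two_pow,
      Nat.zero_testBit] at h1 h2
    simp only [decode, Fin.val_castLE, h1, h2, bit_false, zero_mul, add_zero]
    by_cases hij : i = j
    · simp [hij]
    · have : ¬ (i : ℕ) = j := fun h => hij (Fin.ext h)
      simp [hij, this]
  rw [encode_apply, Finset.sum_apply]
  simp only [Pi.smul_apply, hdec, smul_eq_mul, mul_ite, mul_one, mul_zero]
  simp

lemma weight_le_weight_encode {k : ℕ} {rs : List (ℕ × ℕ)} (hlen : rs.length = k) (hk : k ≤ n)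
    (hsys : ∀ i : Fin rs.length, rs[i].1 % 2 ^ k = 2 ^ (i : ℕ) ∧ rs[i].2 % 2 ^ k = 0)
    (g : Fin rs.length → F4) : weight g ≤ weight (encode n rs g) := by
  rw [weight_eq, weight_eq]
  refine Finset.card_le_card_of_injOn (Fin.castLE (hlen ▸ hk)) ?_ (Fin.castLE_injective _).injOn
  intro j hj
  simp only [Finset.coe_filter, Finset.mem_univ, true_and, Set.mem_ofPred_eq] at hj ⊢
  rwa [encode_apply_castLE hlen hk hsys]

lemma of_checkCode {k d : ℕ} {rs : List (ℕ × ℕ)} (h : checkCode n k d rs = true) :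
    Module.finrank F4 (LinearMap.range (encode n rs)) = k ∧
      ∀ c ∈ LinearMap.range (encode n rs), c ≠ 0 → d ≤ weight c := by
  simp only [checkCode, Bool.and_eq_true, decide_eq_true_eq] at h
  obtain ⟨⟨⟨hlen, hk⟩, hscan⟩, hsys⟩ := h
  constructor
  · rw [LinearMap.finrank_range_of_inj, Module.finrank_fin_fun, hlen]
    intro g g' hg
    funext j
    rw [← encode_apply_castLE hlen hk hsys g, ← encode_apply_castLE hlen hk hsys g', hg]
  · rintro _ ⟨g, rfl⟩ h0
    have h1 := of_scan hscan g
    have h2 := weight_le_weight_encode hlen hk hsys g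
    rw [decode_zero, zero_add, zero_add] at h1
    rcases h1 with h1 | h1 | h1
    · rw [weight_eq_zero] at h1
      rw [h1, map_zero] at h0
      exact absurd rfl h0
    · exact h1.trans h2
    · exact h1

/-- In the basis `h, f₁, …, f_m` the coefficient of `f j` is the product with `f j`. It vanishes for
hull words, which leaves the line of `h`. -/
lemma finrank_hermHull_eq_one {C : Submodule F4 (Fin n → F4)} {m : ℕ}
    (hk : Module.finrank F4 C = m + 1) {h : Fin n → F4} (hC : h ∈ C) (h0 : h ≠ 0)
    (hh : hermInner h h = 0) {f : Fin m → Fin n → F4} (hf : ∀ i, f i ∈ C)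
    (hfh : ∀ i, hermInner (f i) h = 0)
    (hff : ∀ i j, hermInner (f i) (f j) = if i = j then 1 else 0) :
    Module.finrank F4 (hermHull C) = 1 := by
  have hcomb : ∀ (a : F4) (b : Fin m → F4) (j : Fin m),
      hermInner (a • h + ∑ i, b i • f i) (f j) = b j := by
    intro a b j
    have hsum : ∀ s : Finset (Fin m), hermInner (∑ i ∈ s, b i • f i) (f j) =
        ∑ i ∈ s, b i * hermInner (f i) (f j) := by
      intro s
      induction s using Finset.induction_on with
      | empty => simp [hermInner]
      | insert i s hi ih => rw [Finset.sum_insert hi, Finset.sum_insert hi, hermInner_add_left,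
          hermInner_smul_left, ih]
    rw [hermInner_add_left, hermInner_smul_left, hermInner_comm_eq_zero (hfh j), mul_zero, zero_add,
      hsum]
    simp [hff]
  have hli : LinearIndependent F4 (Fin.cons h f : Fin (m + 1) → Fin n → F4) := by
    rw [Fintype.linearIndependent_iff]
    intro g hg
    rw [Fin.sum_univ_succ] at hg
    simp only [Fin.cons_zero, Fin.cons_succ] at hg
    have hb : ∀ j : Fin m, g j.succ = 0 := by
      intro j
      rw [← hcomb (g 0) (fun i => g i.succ) j, hg]
      simp [hermInner]
    simp only [hb, zero_smul, Finset.sum_const_zero, add_zero, smul_eq_zero, h0, or_false] at hg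
    intro i
    exact Fin.cases hg hb i
  have hspan : Submodule.span F4 (Set.range (Fin.cons h f : Fin (m + 1) → Fin n → F4)) = C := by
    refine Submodule.eq_of_le_of_finrank_eq ?_ ?_
    · rw [Submodule.span_le]
      rintro _ ⟨i, rfl⟩
      exact Fin.cases hC hf i
    · rw [finrank_span_eq_card hli, Fintype.card_fin, hk]
  have hrep : ∀ v ∈ C, ∃ (a : F4) (b : Fin m → F4), v = a • h + ∑ i, b i • f i := by
    intro v hv
    rw [← hspan, Submodule.mem_span_range_iff_exists_fun] at hv
    obtain ⟨g, rfl⟩ := hv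
    exact ⟨g 0, fun i => g i.succ, by rw [Fin.sum_univ_succ]; rfl⟩
  suffices hermHull C = Submodule.span F4 {h} by rw [this, finrank_span_singleton h0]
  apply le_antisymm
  · intro v hv
    obtain ⟨a, b, rfl⟩ := hrep v hv.1
    have hb : ∀ j, b j = 0 := by
      intro j
      rw [← hcomb a b j]
      exact hermInner_comm_eq_zero (hv.2 _ (hf j))
    rw [Submodule.mem_span_singleton]
    exact ⟨a, by simp [hb]⟩
  · rw [Submodule.span_singleton_le_iff_mem]
    refine ⟨hC, fun u hu => ?_⟩
    have hle : Submodule.span F4 (Set.range (Fin.cons h f : Fin (m + 1) → Fin n → F4)) ≤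
        hermDual (Submodule.span F4 {h}) := by
      rw [Submodule.span_le]
      rintro _ ⟨i, rfl⟩ w hw
      obtain ⟨a, rfl⟩ := Submodule.mem_span_singleton.1 hw
      rw [hermInner_smul_left]
      refine mul_eq_zero_of_right _ ?_
      refine Fin.cases ?_ (fun j => ?_) i
      · exact hh
      · exact hermInner_comm_eq_zero (hfh j)
    rw [hspan] at hle
    exact hermInner_comm_eq_zero (hle hu h (Submodule.mem_span_singleton_self h))

lemma of_checkHull {k d : ℕ} {rs fs : List (ℕ × ℕ)} {h : ℕ × ℕ} (hc : checkCode n k d rs = true)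
    (hh : checkHull n k rs h fs = true) :
    Module.finrank F4 (hermHull (LinearMap.range (encode n rs))) = 1 := by
  simp only [checkHull, Bool.and_eq_true, decide_eq_true_eq, List.all_eq_true] at hh
  obtain ⟨⟨⟨⟨⟨⟨hlen, hmem⟩, hfmem⟩, h0⟩, hiso⟩, hfh⟩, hff⟩ := hh
  have hrange : ∀ b : ℕ × ℕ, combine b rs 0 = b → decode n b ∈ LinearMap.range (encode n rs) := by
    intro b hb
    obtain ⟨g, hg⟩ := decode_combine (n := n) b rs 0
    rw [hb] at hg
    exact ⟨g, hg.symm⟩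
  refine finrank_hermHull_eq_one (m := fs.length) (h := decode n h) (f := fun i => decode n fs[i])
    ((of_checkCode hc).1.trans hlen.symm) (hrange h hmem) ?_ ?_ ?_ ?_ ?_
  · rw [← weight_decode] at h0
    intro hz
    rw [hz, weight_zero] at h0
    exact h0 rfl
  · simpa using hermInner_decode_eq hiso.1 hiso.2
  · exact fun i => hrange _ (hfmem _ (List.getElem_mem _))
  · exact fun i => by simpa using hermInner_decode_eq (hfh i).1 (hfh i).2
  · intro i j
    rw [hermInner_decode_eq (hff i j).1 (hff i j).2]
    split_ifs <;> simp

end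

/-! ### Explicit codes attaining the table -/

/-- For every table entry in row `n`, the rows of a systematic generator matrix, a vector spanning
the hull, and orthonormal vectors completing it to a basis of the code. -/
def witnesses : ℕ → List (List (ℕ × ℕ) × (ℕ × ℕ) × List (ℕ × ℕ))
  | 2 => [
      ([(3, 2)], (3, 2), [])]
  | 3 => [
      ([(1, 2)], (1, 2), []),
      ([(1, 4), (2, 0)], (1, 4), [(2, 0)])]
  | 4 => [
      ([(13, 10)], (13, 10), []),
      ([(13, 0), (6, 8)], (5, 14), [(13, 0)]),
      ([(9, 8), (10, 8), (12, 0)], (15, 12), [(2, 9), (1, 10)])]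
  | 5 => [
      ([(27, 18)], (27, 18), []),
      ([(5, 28), (18, 4)], (5, 28), [(18, 4)]),
      ([(9, 24), (26, 16), (12, 0)], (15, 14), [(9, 24), (26, 16)]),
      ([(1, 16), (18, 0), (20, 16), (8, 0)], (5, 22), [(19, 16), (19, 2), (8, 0)])]
  | 6 => [
      ([(27, 38)], (27, 38), []),
      ([(37, 8), (62, 28)], (37, 8), [(62, 28)]),
      ([(9, 56), (26, 32), (20, 48)], (51, 34), [(20, 48), (57, 28)]),
      ([(33, 0), (2, 48), (52, 16), (40, 32)], (33, 30), [(2, 48), (19, 2), (51, 20)]),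
      ([(1, 32), (34, 32), (36, 32), (8, 32), (16, 32)], (31, 38), [(35, 0), (33, 34), (3, 46), (15,
       42)])]
  | 7 => [
      ([(15, 90)], (15, 90), []),
      ([(17, 100), (70, 28)], (13, 62), [(17, 100)]),
      ([(81, 96), (98, 8), (60, 16)], (125, 92), [(2, 57), (89, 10)]),
      ([(33, 96), (98, 32), (116, 112), (8, 96)], (99, 2), [(33, 96), (102, 84), (20, 24)]),
      ([(97, 32), (34, 64), (4, 64), (8, 64), (48, 32)], (51, 34), [(97, 32), (34, 64), (75, 6),
       (71, 10)]),
      ([(65, 0), (66, 64), (4, 0), (8, 64), (80, 0), (96, 64)], (89, 42), [(3, 64), (67, 66), (4,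
       0), (65, 26), (89, 18)])]
  | 8 => [
      ([(91, 174)], (91, 174), []),
      ([(169, 180), (118, 252)], (169, 180), [(118, 252)]),
      ([(169, 232), (162, 152), (148, 248)], (148, 248), [(169, 232), (162, 152)]),
      ([(193, 224), (210, 48), (68, 208), (232, 176)], (73, 156), [(210, 48), (19, 208), (70, 116)]),
      ([(193, 96), (98, 96), (68, 96), (200, 224), (240, 192)], (125, 16), [(98, 96), (161, 98),
       (133, 0), (79, 164)]),
      ([(1, 192), (130, 0), (196, 192), (8, 192), (80, 128), (96, 192)], (45, 116), [(1, 192), (1,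
       66), (1, 142), (13, 138), (223, 68)]),
      ([(1, 128), (2, 128), (132, 128), (136, 0), (144, 0), (160, 0), (192, 0)], (7, 252), [(130,
       1), (129, 2), (11, 140), (15, 128), (55, 156), (55, 172)])]
  | 9 => [
      ([(173, 494)], (173, 494), []),
      ([(369, 204), (354, 436)], (369, 204), [(354, 436)]),
      ([(433, 232), (370, 128), (228, 296)], (39, 320), [(433, 232), (67, 410)]),
      ([(177, 352), (434, 0), (228, 432), (296, 480)], (437, 426), [(434, 0), (259, 352), (87,
       388)]),
      ([(289, 64), (450, 224), (356, 320), (456, 256), (80, 384)], (257, 150), [(450, 224), (227,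
       160), (356, 205), (461, 236)]),
      ([(1, 448), (258, 64), (132, 64), (136, 256), (336, 64), (32, 320)], (349, 146), [(258, 64),
       (323, 194), (395, 128), (13, 262), (322, 380)]),
      ([(385, 0), (130, 128), (4, 256), (392, 256), (16, 384), (288, 0), (320, 0)], (151, 496),
       [(385, 0), (257, 2), (139, 384), (141, 2), (434, 428), (137, 34)]),
      ([(1, 0), (258, 256), (4, 0), (8, 0), (16, 0), (288, 256), (64, 256), (128, 0)], (290, 320),
       [(1, 0), (4, 0), (8, 0), (16, 0), (32, 258), (2, 288), (128, 0)])]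
  | 10 => [
      ([(575, 470)], (575, 470), []),
      ([(397, 176), (98, 760)], (791, 210), [(397, 176)]),
      ([(633, 168), (154, 616), (316, 992)], (259, 28), [(633, 168), (154, 616)]),
      ([(225, 288), (930, 768), (996, 80), (120, 224)], (791, 510), [(225, 288), (466, 471), (1015,
       358)]),
      ([(449, 32), (866, 608), (164, 928), (488, 800), (208, 608)], (379, 974), [(449, 32), (866,
       608), (295, 808), (621, 110)]),
      ([(641, 576), (962, 448), (708, 832), (584, 256), (912, 128), (544, 384)], (439, 270), [(962,
       448), (833, 66), (463, 448), (265, 322), (797, 774)]),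
      ([(513, 128), (258, 640), (388, 256), (648, 768), (144, 896), (800, 640), (448, 896)], (873,
       38), [(513, 128), (129, 770), (134, 896), (898, 283), (23, 410), (297, 160)]),
      ([(257, 768), (258, 768), (260, 512), (776, 512), (528, 768), (800, 256), (576, 0), (896, 0)],
       (431, 412), [(257, 768), (258, 768), (515, 772), (532, 280), (531, 768), (271, 348), (587,
       872)]),
      ([(1, 512), (2, 512), (516, 512), (8, 512), (16, 512), (544, 0), (576, 0), (640, 512), (768,
       0)], (159, 996), [(514, 1), (513, 2), (3, 524), (15, 520), (532, 571), (63, 564), (95, 740),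
       (223, 548)])]
  | 11 => [
      ([(2015, 1730)], (2015, 1730), []),
      ([(1785, 1080), (1934, 48)], (1785, 1080), [(1934, 48)]),
      ([(1865, 792), (202, 1832), (1212, 760)], (1678, 916), [(1865, 792), (171, 978)]),
      ([(1841, 944), (1618, 2000), (500, 16), (1224, 736)], (878, 1312), [(1841, 944), (1749, 580),
       (241, 982)]),
      ([(1569, 352), (258, 1952), (324, 736), (168, 1504), (496, 32)], (1217, 708), [(98, 225),
       (385, 1986), (1446, 8), (1246, 1048)]),
      ([(1281, 320), (130, 1600), (1796, 1216), (712, 1088), (336, 832), (1824, 1280)], (1750, 448),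
       [(130, 1600), (833, 1922), (836, 584), (321, 1992), (177, 92)]),
      ([(385, 1408), (258, 896), (1028, 640), (264, 1536), (1168, 768), (1184, 1408), (960, 384)],
       (1206, 1472), [(131, 1536), (513, 1794), (777, 258), (1421, 1286), (525, 1968), (805, 278)]),
      ([(1025, 1280), (514, 768), (1028, 1792), (776, 1792), (1040, 512), (1568, 768), (64, 1792),
       (1664, 512)], (785, 1324), [(1025, 1280), (519, 256), (259, 1284), (16, 96), (613, 876),
       (120, 160), (1398, 928)]),
      ([(1, 512), (1026, 1536), (4, 1024), (1032, 1536), (528, 1024), (1568, 512), (64, 1024), (640,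
       1024), (256, 1024)], (1025, 1860), [(1026, 1536), (1027, 1024), (1036, 30), (1050, 1052),
       (1117, 1548), (1109, 1624), (139, 688), (171, 528)]),
      ([(1, 0), (1026, 0), (1028, 0), (1032, 0), (16, 0), (32, 0), (64, 0), (1152, 1024), (1280, 0),
       (512, 0)], (1294, 128), [(1, 0), (1028, 1026), (1026, 1028), (16, 0), (32, 0), (64, 0), (8,
       1166), (1166, 136), (512, 0)])]
  | 12 => [
      ([(3499, 766)], (3499, 766), []),
      ([(3997, 2932), (3450, 3944)], (743, 1052), [(3997, 2932)]),
      ([(2153, 4080), (194, 2424), (3420, 1752)], (2219, 1672), [(3420, 1752), (3761, 1140)]),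
      ([(1937, 2256), (1074, 1488), (2276, 896), (3464, 1248)], (210, 3256), [(1074, 1488), (1651,
       3298), (35, 1636)]),
      ([(3297, 3168), (1890, 3104), (1572, 2656), (488, 544), (1936, 1216)], (297, 1282), [(1890,
       3104), (2947, 64), (3330, 100), (1270, 328)]),
      ([(1793, 2880), (3202, 3392), (1476, 1600), (2440, 2752), (4048, 3968), (1760, 2240)], (4095,
       52), [(2947, 1536), (1731, 1986), (1795, 1740), (2315, 3718), (2445, 1618)]),
      ([(1409, 2176), (1154, 3584), (388, 3712), (1288, 3968), (2320, 2560), (2976, 640), (1984,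
       3328)], (3323, 966), [(1409, 2176), (1154, 3584), (2817, 1924), (2959, 3330), (3459, 1314),
       (3867, 4006)]),
      ([(2305, 3072), (2, 2816), (3076, 1536), (3848, 2304), (3344, 3328), (1312, 1792), (2368,
       2560), (1920, 2048)], (1315, 1986), [(3074, 3585), (513, 1794), (2314, 2052), (523, 2318),
       (2330, 1300), (1297, 2098), (3698, 1660)]),
      ([(2561, 3072), (514, 2048), (3076, 1024), (1032, 3584), (2576, 2560), (3616, 512), (2624,
       1536), (128, 1536), (3840, 1536)], (2198, 872), [(514, 2048), (3, 3586), (1541, 2048), (3607,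
       2560), (1055, 3092), (3591, 2664), (1599, 1642), (2165, 2286)]),
      ([(2049, 3072), (2050, 2048), (1028, 0), (3080, 2048), (16, 2048), (1056, 0), (3136, 3072),
       (2176, 3072), (2304, 1024), (2560, 1024)], (2058, 3964), [(2049, 3072), (3, 1024), (2063,
       2052), (1035, 3074), (17, 1036), (224, 0), (3293, 26), (257, 1452), (3453, 474)]),
      ([(2049, 2048), (2050, 2048), (2052, 0), (2056, 0), (2064, 2048), (32, 2048), (2112, 0), (128,
       2048), (256, 2048), (2560, 2048), (3072, 2048)], (3679, 2540), [(2, 2049), (1, 2050), (2059,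
       2052), (2055, 2056), (2076, 51), (2111, 2108), (2207, 2284), (2271, 2092), (2911, 3052),
       (2399, 2796)])]
  | _ => []

/-- The witness for the table entry in row `n` and column `k`. -/
def witness (n k : ℕ) : List (ℕ × ℕ) × (ℕ × ℕ) × List (ℕ × ℕ) :=
  (witnesses n).getD (k - 1) ([], (0, 0), [])

lemma checkCode_witness : ∀ n ∈ List.range 13, ∀ k ∈ List.range n, 1 ≤ k →
    checkCode n k (tableEntry n k) (witness n k).1 = true := by
  decide +kernel

lemma checkHull_witness : ∀ n ∈ List.range 13, ∀ k ∈ List.range n, 1 ≤ k →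
    checkHull n k (witness n k).1 (witness n k).2.1 (witness n k).2.2 = true := by
  decide +kernel

/-- Generator matrices of codes whose distance exceeds the table entry. -/
def betterCode : ℕ × ℕ → List (ℕ × ℕ)
  | (10, 4) => [(209, 976), (738, 368), (804, 992), (952, 416)]
  | (11, 5) => [(1889, 1728), (1058, 1952), (1380, 480), (232, 768), (1488, 2016)]
  | (11, 6) => [(1985, 832), (450, 1920), (1284, 192), (200, 1600), (528, 1984), (800, 1344)]
  | _ => []

lemma checkCode_betterCode : ∀ p ∈ [(10, 4), (11, 5), (11, 6)],
    checkCode p.1 p.2 (tableEntry p.1 p.2 + 1) (betterCode p) = true := by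
  decide +kernel

/-! ### The finite search behind the parameters `[11, 5, 6]` -/

/-- Whether the scalar `s + t ω` is nonzero, as a number. -/
def nzBit (s t : Bool) : ℕ := if s || t then 1 else 0

/-- Adding any constant to the coded vector of length six leaves weight at least `6 - z`. -/
noncomputable def okWord (z : ℕ) (p : ℕ × ℕ) : Bool :=
  [(0, 0), (63, 0), (0, 63), (63, 63)].all fun l =>
    Nat.ble 6 (popCount 6 ((p.1 ^^^ l.1) ||| (p.2 ^^^ l.2)) + z)

/-- The weight condition on `u + (s₁ + t₁ ω) v + (s₂ + t₂ ω) w`. -/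
noncomputable def okComb (u v w : ℕ × ℕ) (s₁ t₁ s₂ t₂ : Bool) : Bool :=
  okWord (1 + nzBit s₁ t₁ + nzBit s₂ t₂ + nzBit (true ^^ s₁ ^^ s₂) (t₁ ^^ t₂))
    (u.1 ^^^ (scaleCode s₁ t₁ v).1 ^^^ (scaleCode s₂ t₂ w).1,
      u.2 ^^^ (scaleCode s₁ t₁ v).2 ^^^ (scaleCode s₂ t₂ w).2)

/-- The weight condition on all combinations of two vectors. -/
noncomputable def okPair (u v : ℕ × ℕ) : Bool :=
  [(true, false), (false, true), (true, true)].all fun q => okComb u v v q.1 q.2 false false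

/-- The weight condition on all combinations of three vectors with nonzero coefficients. -/
noncomputable def okTriple (u v w : ℕ × ℕ) : Bool :=
  [(true, false), (false, true), (true, true)].all fun q =>
    [(true, false), (false, true), (true, true)].all fun q' => okComb u v w q.1 q.2 q'.1 q'.2

/-- The coded vectors of length six with coordinate sum zero that satisfy the weight condition. -/
noncomputable def hexads : List (ℕ × ℕ) :=
  let evens := (List.range 64).filter fun a => popCount 6 a % 2 == 0
  (evens ×ˢ evens).filter fun p => okComb p p p false false false false

/-- The integer coding the `i`-th coordinate of a coded vector. -/
def digit (p : ℕ × ℕ) (i : ℕ) : ℕ := (p.1.testBit i).toNat + 2 * (p.2.testBit i).toNat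

/-- The coded vectors among `hexads` with increasing coordinates. -/
noncomputable def sortedHexads : List (ℕ × ℕ) :=
  hexads.filter fun p => (List.range 5).all fun i => (digit p i).ble (digit p (i + 1))

/-- The coded vectors among `hexads` whose first coordinate is zero. -/
noncomputable def pointedHexads : List (ℕ × ℕ) := hexads.filter fun p => digit p 0 == 0

/-- There are no four compatible vectors. -/
noncomputable def searchHexads : Bool :=
  sortedHexads.all fun u =>
    let L := pointedHexads.filter (okPair u)
    L.all fun a => L.all fun b => !(okPair a b && okTriple u a b) ||
      L.all fun c => !(okPair a c && okPair b c && okTriple u a c && okTriple u b c &&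
        okTriple a b c)

lemma searchHexads_eq_true : searchHexads = true := by decide +kernel

section
open scoped Classical
variable {n : ℕ}

/-- The indicator of nonzero scalars. -/
noncomputable def nz (x : F4) : ℕ := if x = 0 then 0 else 1

lemma weight_eq_sum_nz (c : Fin n → F4) : weight c = ∑ i, nz (c i) := by
  rw [weight_eq, Finset.card_filter]
  simp only [nz, Ne, ite_not]

lemma nz_mul {a : F4} (ha : a ≠ 0) (x : F4) : nz (a * x) = nz x := by
  simp [nz, ha]

lemma nz_le_one (x : F4) : nz x ≤ 1 := by
  rw [nz]
  split_ifs <;> omega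

lemma nz_bit (s t : Bool) : nz (bit s + bit t * ω) = nzBit s t := by
  rw [nz, nzBit, bit_add_bit_mul_eq_zero]
  cases s <;> cases t <;> simp

lemma weight_comp_perm (σ : Equiv.Perm (Fin n)) (c : Fin n → F4) :
    weight (fun i => c (σ i)) = weight c := by
  rw [weight_eq_sum_nz, weight_eq_sum_nz]
  exact Equiv.sum_comp σ fun i => nz (c i)

/-- The first bit of a scalar in the basis `1, ω`. -/
noncomputable def loBit (x : F4) : Bool := decide (x = 1 ∨ x = ω + 1)

/-- The second bit of a scalar in the basis `1, ω`. -/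
noncomputable def hiBit (x : F4) : Bool := decide (x = ω ∨ x = ω + 1)

lemma bit_loBit_add (x : F4) : bit (loBit x) + bit (hiBit x) * ω = x := by
  have h1 : (0 : F4) ≠ ω + 1 := ω_add_one_ne_zero.symm
  rcases F4_cases x with rfl | rfl | rfl | rfl <;>
    simp [loBit, hiBit, ω_ne_zero, ω_ne_zero.symm, ω_ne_one, ω_ne_one.symm, h1, add_comm]

lemma loBit_zero : loBit 0 = false := by
  simp [loBit, ω_add_one_ne_zero.symm]

lemma hiBit_zero : hiBit 0 = false := by
  simp [hiBit, ω_ne_zero.symm, ω_add_one_ne_zero.symm]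

/-- The coding of a vector by a pair of bit masks. -/
noncomputable def toCode (v : Fin n → F4) : ℕ × ℕ :=
  (Nat.ofBits fun i => loBit (v i), Nat.ofBits fun i => hiBit (v i))

lemma toCode_testBit (v : Fin n → F4) (i : Fin n) :
    (toCode v).1.testBit i = loBit (v i) ∧ (toCode v).2.testBit i = hiBit (v i) :=
  ⟨Nat.testBit_ofBits_lt _ _ i.2, Nat.testBit_ofBits_lt _ _ i.2⟩

lemma decode_toCode (v : Fin n → F4) : decode n (toCode v) = v := by
  funext i
  rw [decode, (toCode_testBit v i).1, (toCode_testBit v i).2, bit_loBit_add]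

lemma toCode_lt (v : Fin n → F4) : (toCode v).1 < 2 ^ n ∧ (toCode v).2 < 2 ^ n :=
  ⟨Nat.ofBits_lt_two_pow _, Nat.ofBits_lt_two_pow _⟩

lemma natCast_F4_eq_bit (a : ℕ) : (a : F4) = bit (a % 2 == 1) := by
  rw [natCast_F4_eq_mod]
  rcases Nat.mod_two_eq_zero_or_one a with h | h <;> simp [h]

lemma popCount_even_of_sum_eq_zero {p : ℕ × ℕ} (h : ∑ i, decode n p i = 0) :
    popCount n p.1 % 2 = 0 ∧ popCount n p.2 % 2 = 0 := by
  simp only [decode, Finset.sum_add_distrib, ← Finset.sum_mul, ← natCast_popCount] at h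
  rw [natCast_F4_eq_bit, natCast_F4_eq_bit (popCount n p.2), bit_add_bit_mul_eq_zero] at h
  simpa using h

lemma okWord_of_weight {z : ℕ} {p : ℕ × ℕ}
    (h : ∀ a : F4, 6 ≤ weight (fun j => decode 6 p j + a) + z) : okWord z p = true := by
  have hconst : ∀ s t : Bool, decode 6 (if s then 63 else 0, if t then 63 else 0) =
      fun _ => bit s + bit t * ω := by
    intro s t
    funext i
    have h63 : Nat.testBit 63 i = true := by
      fin_cases i <;> decide
    cases s <;> cases t <;> simp [decode, h63]
  have key : ∀ s t : Bool, 6 ≤ popCount 6 ((p.1 ^^^ if s then 63 else 0) |||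
      (p.2 ^^^ if t then 63 else 0)) + z := by
    intro s t
    have h1 := h (bit s + bit t * ω)
    have h2 := weight_decode (n := 6) (p.1 ^^^ (if s then 63 else 0), p.2 ^^^ if t then 63 else 0)
    rw [decode_xor, hconst s t] at h2
    rw [← h2]
    exact h1
  simp only [okWord, List.all_cons, List.all_nil, Bool.and_true, Bool.and_eq_true, Nat.ble_eq]
  exact ⟨key false false, key true false, key false true, key true true⟩

/-- The weight condition satisfied by vectors of length six derived from an `[11, 5, 6]` code. -/
def Compatible (v : Fin 4 → Fin 6 → F4) : Prop :=
  ∀ x y z : Fin 4, x ≠ y → x ≠ z → y ≠ z → ∀ b c a : F4,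
    6 ≤ weight (fun j => v x j + b * v y j + c * v z j + a) + (1 + nz b + nz c + nz (1 + b + c))

lemma Compatible.okComb {v : Fin 4 → Fin 6 → F4} (hv : Compatible v) {x y z : Fin 4} (hxy : x ≠ y)
    (hxz : x ≠ z) (hyz : y ≠ z) (s₁ t₁ s₂ t₂ : Bool) :
    okComb (toCode (v x)) (toCode (v y)) (toCode (v z)) s₁ t₁ s₂ t₂ = true := by
  refine okWord_of_weight fun a => ?_
  have h := hv x y z hxy hxz hyz (bit s₁ + bit t₁ * ω) (bit s₂ + bit t₂ * ω) a
  rw [decode_xor, decode_xor, decode_scaleCode, decode_scaleCode, decode_toCode, decode_toCode,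
    decode_toCode]
  rw [nz_bit, nz_bit, show (1 : F4) + (bit s₁ + bit t₁ * ω) + (bit s₂ + bit t₂ * ω) =
    bit (true ^^ s₁ ^^ s₂) + bit (t₁ ^^ t₂) * ω by rw [bit_xor, bit_xor, bit_xor, bit_true]; ring,
    nz_bit] at h
  exact h

lemma Compatible.okPair {v : Fin 4 → Fin 6 → F4} (hv : Compatible v) {x y : Fin 4} (hxy : x ≠ y) :
    okPair (toCode (v x)) (toCode (v y)) = true := by
  obtain ⟨z, hxz, hyz⟩ : ∃ z : Fin 4, x ≠ z ∧ y ≠ z := by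
    revert x y
    decide
  simp only [Quaternary.okPair, List.all_eq_true]
  exact fun q _ => hv.okComb hxy hxz hyz q.1 q.2 false false

lemma Compatible.okTriple {v : Fin 4 → Fin 6 → F4} (hv : Compatible v) {x y z : Fin 4}
    (hxy : x ≠ y) (hxz : x ≠ z) (hyz : y ≠ z) :
    okTriple (toCode (v x)) (toCode (v y)) (toCode (v z)) = true := by
  simp only [Quaternary.okTriple, List.all_eq_true]
  exact fun q _ q' _ => hv.okComb hxy hxz hyz q.1 q.2 q'.1 q'.2

lemma Compatible.mem_hexads {v : Fin 4 → Fin 6 → F4} (hv : Compatible v) {x : Fin 4}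
    (hx : ∑ j, v x j = 0) : toCode (v x) ∈ hexads := by
  obtain ⟨y, z, hxy, hxz, hyz⟩ : ∃ y z : Fin 4, x ≠ y ∧ x ≠ z ∧ y ≠ z := by
    clear hx
    revert x
    decide
  have h := popCount_even_of_sum_eq_zero (n := 6) (p := toCode (v x)) (by rwa [decode_toCode])
  have hlt := toCode_lt (v x)
  have hok : Quaternary.okComb (toCode (v x)) (toCode (v x)) (toCode (v x)) false false false false
      = true := hv.okComb hxy hxz hyz false false false false
  rw [hexads, List.mem_filter]
  refine ⟨List.pair_mem_product.2 ⟨?_, ?_⟩, hok⟩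
  · simpa [List.mem_filter] using ⟨hlt.1, h.1⟩
  · simpa [List.mem_filter] using ⟨hlt.2, h.2⟩

lemma digit_toCode (v : Fin 6 → F4) (i : Fin 6) :
    digit (toCode v) i = (loBit (v i)).toNat + 2 * (hiBit (v i)).toNat := by
  rw [digit, (toCode_testBit v i).1, (toCode_testBit v i).2]

/-- The constants `t` only shift the arbitrary constant `a`. This symmetry keeps the search small.
-/
lemma Compatible.normalize {v : Fin 4 → Fin 6 → F4} (hv : Compatible v) (σ : Equiv.Perm (Fin 6))
    (t : Fin 4 → F4) : Compatible fun m j => v m (σ j) + t m := by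
  intro x y z hxy hxz hyz b c a
  have h := hv x y z hxy hxz hyz b c (t x + b * t y + c * t z + a)
  rw [← weight_comp_perm σ] at h
  convert h using 3
  funext j
  ring

lemma not_compatible {v : Fin 4 → Fin 6 → F4} (hsum : ∀ m, ∑ j, v m j = 0) : ¬ Compatible v := by
  intro hv
  let σ := Tuple.sort fun j => (loBit (v 0 j)).toNat + 2 * (hiBit (v 0 j)).toNat
  have hσ : Monotone ((fun j => (loBit (v 0 j)).toNat + 2 * (hiBit (v 0 j)).toNat) ∘ σ) :=
    Tuple.monotone_sort _
  -- The permutation sorts the first vector, which is not translated; the other three are translated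
  -- to vanish at the first coordinate.
  let t : Fin 4 → F4 := fun m => if m = 0 then 0 else v m (σ 0)
  have hw := hv.normalize σ t
  set w : Fin 4 → Fin 6 → F4 := fun m j => v m (σ j) + t m with hwdef
  have hws : ∀ m, ∑ j, w m j = 0 := by
    intro m
    simp only [hwdef, Finset.sum_add_distrib]
    rw [Equiv.sum_comp σ (v m), hsum]
    simp only [Finset.sum_const, Finset.card_univ, Fintype.card_fin, nsmul_eq_mul]
    push_cast
    linear_combination 3 * t m * F4_two
  have hmem := fun m => hw.mem_hexads (hws m)
  have h0 : toCode (w 0) ∈ sortedHexads := by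
    rw [sortedHexads, List.mem_filter, List.all_eq_true]
    refine ⟨hmem 0, fun i hi => ?_⟩
    rw [List.mem_range] at hi
    have h1 := digit_toCode (w 0) ⟨i, by omega⟩
    have h2 := digit_toCode (w 0) ⟨i + 1, by omega⟩
    have h3 := hσ (a := ⟨i, by omega⟩) (b := ⟨i + 1, by omega⟩) (by simp)
    rw [Nat.ble_eq]
    simp only at h1 h2
    rw [h1, h2]
    simpa [hwdef, t] using h3
  have hp : ∀ m, m ≠ 0 → toCode (w m) ∈ pointedHexads.filter (okPair (toCode (w 0))) := by
    intro m hm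
    rw [List.mem_filter, pointedHexads, List.mem_filter]
    refine ⟨⟨hmem m, ?_⟩, hw.okPair hm.symm⟩
    have h1 : w m 0 = 0 := by
      simp only [hwdef, t, if_neg hm]
      linear_combination v m (σ 0) * F4_two
    have h2 := digit_toCode (w m) 0
    rw [h1, loBit_zero, hiBit_zero] at h2
    simpa using h2
  have hs := searchHexads_eq_true
  rw [searchHexads, List.all_eq_true] at hs
  have h1 := hs _ h0
  simp only [List.all_eq_true (l := List.filter _ _)] at h1
  have h2 := h1 _ (hp 1 (by decide)) _ (hp 2 (by decide))
  rw [hw.okPair (by decide), hw.okTriple (by decide) (by decide) (by decide)] at h2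
  simp only [Bool.and_self, Bool.not_true, Bool.false_or, List.all_eq_true] at h2
  have h3 := h2 _ (hp 3 (by decide))
  rw [hw.okPair (by decide), hw.okPair (by decide), hw.okTriple (by decide) (by decide) (by decide),
    hw.okTriple (by decide) (by decide) (by decide),
    hw.okTriple (by decide) (by decide) (by decide)] at h3
  simp at h3

/-! ### From an `[11, 5, 6]` code to the search -/

lemma exists_notMem_span_singleton {C : Submodule F4 (Fin n → F4)} (h : Fin n → F4)
    (hC : 2 ≤ Module.finrank F4 C) : ∃ c ∈ C, c ∉ Submodule.span F4 {h} := by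
  by_contra! hle
  have h1 := Submodule.finrank_mono (s := C) (t := Submodule.span F4 {h}) hle
  have h2 := finrank_span_le_card (R := F4) ({h} : Set (Fin n → F4))
  simp only [Set.toFinset_singleton, Finset.card_singleton] at h2
  omega

/-- The weight splits over the zeros and the support of a word `h`. -/
lemma weight_add_smul_eq {h : Fin n → F4} {p q : ℕ} (z : Fin p ≃ {i // h i = 0})
    (e : Fin q ≃ {i // ¬ h i = 0}) (w : Fin n → F4) (a : F4) :
    weight (w + a • h) = ∑ j, nz (w (z j)) + weight (fun j => w (e j) / h (e j) + a) := by
  rw [weight_eq_sum_nz, weight_eq_sum_nz, ← Fintype.sum_subtype_add_sum_subtype (fun i => h i = 0),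
    ← Equiv.sum_comp z, ← Equiv.sum_comp e]
  congr 1
  · refine Finset.sum_congr rfl fun j _ => ?_
    simp [(z j).2]
  · refine Finset.sum_congr rfl fun j _ => ?_
    rw [← nz_mul (e j).2 (w (e j) / h (e j) + a)]
    congr 1
    have := (e j).2
    simp only [Pi.add_apply, Pi.smul_apply, smul_eq_mul]
    field_simp

/-- Among six entries from four scalars some value `a` repeats, and adding `a` cancels it in
characteristic two. -/
lemma exists_weight_add_le (f : Fin 6 → F4) : ∃ a : F4, weight (fun j => f j + a) ≤ 4 := by
  obtain ⟨a, ha⟩ := Fintype.exists_lt_card_fiber_of_mul_lt_card (f := f) (n := 1)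
    (by rw [F4_card]; simp)
  refine ⟨a, ?_⟩
  have h := Finset.card_filter_add_card_filter_not (s := Finset.univ) (fun j => f j = a)
  rw [Finset.card_univ, Fintype.card_fin] at h
  have h2 : (Finset.univ.filter fun j => f j + a ≠ 0) = Finset.univ.filter fun j => ¬ f j = a := by
    ext j
    simp [CharTwo.add_eq_zero]
  rw [weight_eq, h2]
  omega

/-- On the support of `h` the inverse of a coordinate is its square. -/
lemma sum_div_eq_hermInner {h : Fin n → F4} {q : ℕ} (e : Fin q ≃ {i // ¬ h i = 0})
    (c : Fin n → F4) : ∑ j, c (e j) / h (e j) = hermInner c h := by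
  rw [hermInner, ← Fintype.sum_subtype_add_sum_subtype (fun i => h i = 0),
    Finset.sum_eq_zero (s := Finset.univ) (f := fun i : {i // h i = 0} => c i * h i ^ 2)
      (fun i _ => by simp [i.2]), zero_add, ← Equiv.sum_comp e]
  refine Finset.sum_congr rfl fun j _ => ?_
  have h3 := F4_pow_three (e j).2
  have h0 := (e j).2
  rw [div_eq_iff h0]
  linear_combination -c (e j) * h3

/-- An `[11, 5]` code with one-dimensional hull has minimum distance less than six. -/
lemma exists_weight_lt_of_11_5 {C : Submodule F4 (Fin 11 → F4)} (hk : Module.finrank F4 C = 5)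
    (hl : Module.finrank F4 (hermHull C) = 1) : ∃ c ∈ C, c ≠ 0 ∧ weight c < 6 := by
  by_contra! hd
  obtain ⟨h, hne, hh⟩ := exists_hermHull_eq_span hl
  have hmem : h ∈ hermHull C := hh ▸ Submodule.mem_span_singleton_self h
  have hw6 : weight h = 6 := weight_eq_six_of_11_5_6 (S := Finset.univ) (by simp) (by simp) hk hd
    hne hh
  have hce : Fintype.card {i // ¬ h i = 0} = 6 := by
    rw [Fintype.card_subtype]
    exact hw6
  have hcz : Fintype.card {i // h i = 0} = 5 := by
    have := Fintype.card_subtype_compl (fun i => h i = 0)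
    have h2 := Fintype.card_subtype_le (fun i => h i = 0)
    rw [hce, Fintype.card_fin] at this
    rw [Fintype.card_fin] at h2
    omega
  let z : Fin 5 ≃ {i // h i = 0} := (Fintype.equivFinOfCardEq hcz).symm
  let e : Fin 6 ≃ {i // ¬ h i = 0} := (Fintype.equivFinOfCardEq hce).symm
  -- A suitable multiple of `h` brings the weight on the support of `h` down to four, so the total
  -- is at most five. Hence `C` modulo `h` is a `[5, 4]` code of distance at least two on the zeros
  -- of `h`.
  have hA : ∀ w ∈ C, ∑ j, nz (w (z j)) ≤ 1 → w ∈ Submodule.span F4 {h} := by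
    intro w hw hle
    obtain ⟨a, ha⟩ := exists_weight_add_le fun j => w (e j) / h (e j)
    have h1 := weight_add_smul_eq z e w a
    have h2 : w + a • h = 0 := by
      by_contra hne'
      have := hd _ (C.add_mem hw (C.smul_mem a hmem.1)) hne'
      omega
    rw [eq_neg_of_add_eq_zero_left h2, ← neg_smul]
    exact Submodule.mem_span_singleton.2 ⟨-a, rfl⟩
  -- Vanishing at the other three zeros of `h` leaves dimension at least two, hence a word outside
  -- the line of `h`; by `hA` it is nonzero at both remaining zeros.
  have hc : ∀ m : Fin 4, ∃ c ∈ C, c (z 0) = 1 ∧ c (z m.succ) ≠ 0 ∧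
      ∀ j : Fin 4, j ≠ m → c (z j.succ) = 0 := by
    intro m
    let T : Finset (Fin 11) := (Finset.univ.erase m).image fun j : Fin 4 => (z j.succ : Fin 11)
    have hT : T.card ≤ 3 := by
      refine Finset.card_image_le.trans ?_
      rw [Finset.card_erase_of_mem (Finset.mem_univ m)]
      simp
    have h1 := finrank_le_finrank_shorten C T
    obtain ⟨c, hcT, hcs⟩ := exists_notMem_span_singleton (C := shorten C T) h (by omega)
    have hzero : ∀ j : Fin 4, j ≠ m → c (z j.succ) = 0 := fun j hj =>
      hcT.2 _ (Finset.mem_image.2 ⟨j, Finset.mem_erase.2 ⟨hj, Finset.mem_univ j⟩, rfl⟩)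
    have hs : ∑ j, nz (c (z j)) = nz (c (z 0)) + nz (c (z m.succ)) := by
      rw [Fin.sum_univ_succ, Finset.sum_eq_single m]
      · intro j _ hj
        simp [hzero j hj, nz]
      · simp
    have h0 : c (z 0) ≠ 0 := by
      intro h0
      refine hcs (hA c hcT.1 ?_)
      rw [hs, h0]
      simpa [nz] using nz_le_one (c (z m.succ))
    have hm0 : c (z m.succ) ≠ 0 := by
      intro h0
      refine hcs (hA c hcT.1 ?_)
      rw [hs, h0]
      simpa [nz] using nz_le_one (c (z 0))
    refine ⟨(c (z 0))⁻¹ • c, C.smul_mem _ hcT.1, ?_, ?_, ?_⟩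
    · simp [h0]
    · simp [h0, hm0]
    · intro j hj
      simp [hzero j hj]
  choose c hcC hc0 hcm hcj using hc
  refine not_compatible (v := fun m j => c m (e j) / h (e j)) (fun m => ?_) ?_
  · rw [sum_div_eq_hermInner e (c m)]
    exact hmem.2 _ (hcC m)
  · intro x y t hxy hxt hyt a b s
    have hwC : c x + a • c y + b • c t ∈ C :=
      C.add_mem (C.add_mem (hcC x) (C.smul_mem a (hcC y))) (C.smul_mem b (hcC t))
    have h1 := weight_add_smul_eq z e (c x + a • c y + b • c t) s
    have hne' : c x + a • c y + b • c t + s • h ≠ 0 := by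
      intro h0
      have := congrFun h0 (z x.succ)
      simp [hcj y x hxy, hcj t x hxt, (z x.succ).2] at this
      exact hcm x this
    have h2 := hd _ (C.add_mem hwC (C.smul_mem s hmem.1)) hne'
    -- The coordinate `z 0` carries `1 + a + b`, and each of the three words has one further zero of
    -- `h` to itself.
    have h3 : ∑ j, nz ((c x + a • c y + b • c t) (z j)) ≤ 1 + nz a + nz b + nz (1 + a + b) := by
      rw [Fin.sum_univ_succ]
      have h4 : ∀ j : Fin 4, nz ((c x + a • c y + b • c t) (z j.succ)) ≤
          (if j = x then 1 else 0) + (if j = y then nz a else 0) + (if j = t then nz b else 0) := by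
        intro j
        by_cases hjx : j = x
        · rw [if_pos hjx]
          exact (nz_le_one _).trans (by omega)
        by_cases hjy : j = y
        · subst hjy
          simp [hcj x j hjx, hcj t j hyt, hjx, hyt, mul_comm a, nz_mul (hcm j)]
        by_cases hjt : j = t
        · subst hjt
          simp [hcj x j hjx, hcj y j hjy, hjx, hjy, mul_comm b, nz_mul (hcm j)]
        · simp [hcj x j hjx, hcj y j hjy, hcj t j hjt, nz]
      have h5 := Finset.sum_le_sum fun j (_ : j ∈ Finset.univ) => h4 j
      simp only [Finset.sum_add_distrib, Finset.sum_ite_eq', Finset.mem_univ, if_true] at h5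
      have h6 : (c x + a • c y + b • c t) (z 0) = 1 + a + b := by simp [hc0]
      rw [h6]
      omega
    rw [h1] at h2
    have h7 : (fun j => (c x + a • c y + b • c t) (e j) / h (e j) + s) = fun j =>
        c x (e j) / h (e j) + a * (c y (e j) / h (e j)) + b * (c t (e j) / h (e j)) + s := by
      funext j
      simp only [Pi.add_apply, Pi.smul_apply, smul_eq_mul]
      ring
    rw [h7] at h2
    beta_reduce
    omega

/-! ### The parameters `[11, 6, 5]` by Hermitian duality -/

lemma le_finrank_hermDual (C : Submodule F4 (Fin n → F4)) :
    n ≤ Module.finrank F4 (hermDual C) + Module.finrank F4 C := by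
  have b := Module.finBasis F4 C
  have h := finrank_le_of_ker (C := ⊤) (D := hermDual C) (W := Fin (Module.finrank F4 C) → F4)
    (LinearMap.pi fun j => (
      { toFun := fun v => hermInner v (b j)
        map_add' := fun u v => hermInner_add_left u v _
        map_smul' := fun a v => hermInner_smul_left a v _ } : (Fin n → F4) →ₗ[F4] F4) ∘ₗ
      (⊤ : Submodule F4 (Fin n → F4)).subtype) (by
      intro v hv
      have hle : C ≤ hermDual (Submodule.span F4 {(v : Fin n → F4)}) := by
        intro u hu
        have hsum := congrArg Subtype.val (b.sum_repr ⟨u, hu⟩)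
        simp only [Submodule.coe_sum, Submodule.coe_smul] at hsum
        rw [← hsum]
        refine Submodule.sum_mem _ fun j _ => Submodule.smul_mem _ _ ?_
        intro w hw
        obtain ⟨a, rfl⟩ := Submodule.mem_span_singleton.1 hw
        rw [hermInner_smul_left]
        exact mul_eq_zero_of_right _ (congrFun hv j)
      intro u hu
      exact hermInner_comm_eq_zero (hle hu _ (Submodule.mem_span_singleton_self _)))
  simpa using h

lemma lt_weight_of_mem_hermDual {C : Submodule F4 (Fin n → F4)} {k d e : ℕ}
    (hk : Module.finrank F4 C = k) (hd : ∀ c ∈ C, c ≠ 0 → d ≤ weight c) (hek : e ≤ k)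
    (hex : ∀ t ≤ e, Excluded (n - t) (k - t + 1) d) {v : Fin n → F4} (hv : v ∈ hermDual C)
    (h0 : v ≠ 0) : e < weight v := by
  by_contra! hle
  obtain ⟨i, hi⟩ : ∃ i, v i ≠ 0 := by
    by_contra! h
    exact h0 (funext h)
  have hTw : (Finset.univ.filter fun i => v i ≠ 0).card = weight v := (weight_eq v).symm
  obtain ⟨c, hc, hci, hcj⟩ := exists_mem_eq_single (S := Finset.univ) (m := n) (by simp) (by simp)
    hk hd (T := Finset.univ.filter fun i => v i ≠ 0) (Finset.subset_univ _) (by omega)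
    (hex _ (by omega)) (i := i) (by simpa using hi)
  have hs := hv c hc
  rw [hermInner, Finset.sum_eq_single i] at hs
  · exact (mul_ne_zero hci (pow_ne_zero 2 hi)) hs
  · intro j _ hj
    by_cases h : v j = 0
    · simp [h]
    · rw [hcj j (by simpa using h) hj, zero_mul]
  · simp

/-- An `[11, 6]` code with one-dimensional hull has minimum distance less than five. -/
lemma exists_weight_lt_of_11_6 {C : Submodule F4 (Fin 11 → F4)} (hk : Module.finrank F4 C = 6)
    (hl : Module.finrank F4 (hermHull C) = 1) : ∃ c ∈ C, c ≠ 0 ∧ weight c < 5 := by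
  by_contra! hd
  have hdual : ∀ v ∈ hermDual C, v ≠ 0 → 6 ≤ weight v := fun v hv h0 =>
    lt_weight_of_mem_hermDual (e := 5) hk hd (by norm_num)
      (fun t ht => excluded_of_sporadic (by interval_cases t <;> decide)) hv h0
  have h1 := le_finrank_hermDual C
  -- Counting equations only bounds the dimension of the dual from below; a larger dual would
  -- violate the known distance bounds. The same argument identifies the double dual with `C`.
  have hDk : Module.finrank F4 (hermDual C) = 5 := by
    by_contra hne
    obtain ⟨v, hv, h0, hw⟩ := (excluded_of_sporadic (m := 11) (k := 6) (d := 6) (by decide)).exists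
      (C := hermDual C) (S := Finset.univ) (by simp) (by simp) (by omega)
    have := hdual v hv h0
    omega
  have h2 := le_finrank_hermDual (hermDual C)
  have hle : C ≤ hermDual (hermDual C) := fun c hc v hv => hermInner_comm_eq_zero (hv c hc)
  have hDDk : Module.finrank F4 (hermDual (hermDual C)) = 6 := by
    by_contra hne
    obtain ⟨v, hv, h0, hw⟩ := (excluded_of_sporadic (m := 11) (k := 7) (d := 5) (by decide)).exists
      (C := hermDual (hermDual C)) (S := Finset.univ) (by simp) (by simp) (by omega)
    have := lt_weight_of_mem_hermDual (e := 4) hDk hdual (by norm_num)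
      (fun t ht => excluded_of_sporadic (by interval_cases t <;> decide)) hv h0
    omega
  have heq : hermDual (hermDual C) = C :=
    (Submodule.eq_of_le_of_finrank_eq hle (hk.trans hDDk.symm)).symm
  have hhull : hermHull (hermDual C) = hermHull C := by
    rw [hermHull, heq, inf_comm]
    rfl
  obtain ⟨v, hv, h0, hw⟩ := exists_weight_lt_of_11_5 hDk (hhull ▸ hl)
  have := hdual v hv h0
  omega

/-! ### Assembly of the table -/

lemma exists_weight_le_tableEntry {n k : ℕ} (hk1 : 1 ≤ k) (hkn : k < n) (hn : n ≤ 12)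
    {C : Submodule F4 (Fin n → F4)} (hk : Module.finrank F4 C = k)
    (hl : Module.finrank F4 (hermHull C) = 1) :
    ∃ c ∈ C, c ≠ 0 ∧ weight c < tableEntry n k + 1 := by
  rcases exclude_tableEntry_or n (List.mem_range.2 (by omega)) k (List.mem_range.2 hkn) hk1 with
    h | h
  · exact (excluded_of_sporadic h).exists (S := Finset.univ) (by simp) (by simp) hk.ge
  · simp only [hullSensitive, List.mem_cons, Prod.mk.injEq, List.not_mem_nil, or_false] at h
    rcases h with ⟨rfl, rfl⟩ | ⟨rfl, rfl⟩ | ⟨rfl, rfl⟩ | ⟨rfl, rfl⟩ | ⟨rfl, rfl⟩ | ⟨rfl, rfl⟩ |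
      ⟨rfl, rfl⟩ | ⟨rfl, rfl⟩ | ⟨rfl, rfl⟩ | ⟨rfl, rfl⟩ | ⟨rfl, rfl⟩ | ⟨rfl, rfl⟩ | ⟨rfl, rfl⟩ |
      ⟨rfl, rfl⟩ | ⟨rfl, rfl⟩ | ⟨rfl, rfl⟩ | ⟨rfl, rfl⟩ | ⟨rfl, rfl⟩
    · exact (noWeightDistribution_one (by simp)).exists hk hl
    · exact (noWeightDistribution_one (by simp)).exists hk hl
    · exact (noWeightDistribution_one (by simp)).exists hk hl
    · exact (noWeightDistribution_one (by simp)).exists hk hl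
    · exact (noWeightDistribution_one (by simp)).exists hk hl
    · exact noWeightDistribution_3_2.exists hk hl
    · exact noWeightDistribution_5_4.exists hk hl
    · exact noWeightDistribution_7_6.exists hk hl
    · exact noWeightDistribution_9_8.exists hk hl
    · exact noWeightDistribution_11_10.exists hk hl
    · exact noWeightDistribution_5_2.exists hk hl
    · exact noWeightDistribution_5_3.exists hk hl
    · exact noWeightDistribution_6_3.exists hk hl
    · exact noWeightDistribution_8_2.exists hk hl
    · exact noWeightDistribution_10_2.exists hk hl
    · by_contra! hd
      exact finrank_hermHull_ne_one_of_10_4_6 (S := Finset.univ) (by simp) (by simp) hk hd hl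
    · exact exists_weight_lt_of_11_5 hk hl
    · exact exists_weight_lt_of_11_6 hk hl

lemma isD4H_tableEntry {n k : ℕ} (hk1 : 1 ≤ k) (hkn : k < n) (hn : n ≤ 12) :
    IsD4H n k 1 (tableEntry n k) := by
  constructor
  · have hc := checkCode_witness n (List.mem_range.2 (by omega)) k (List.mem_range.2 hkn) hk1
    have hh := checkHull_witness n (List.mem_range.2 (by omega)) k (List.mem_range.2 hkn) hk1
    obtain ⟨hdim, hd⟩ := of_checkCode hc
    have hl := of_checkHull hc hh
    refine ⟨_, ⟨hdim, ?_, ?_⟩, hl⟩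
    -- The witness check only bounds the distance from below; the upper bound applied to the same
    -- code makes it exact.
    · obtain ⟨c, hcC, h0, hw⟩ := exists_weight_le_tableEntry hk1 hkn hn hdim hl
      exact ⟨c, hcC, h0, le_antisymm (Nat.le_of_lt_succ hw) (hd c hcC h0)⟩
    · rintro _ ⟨c, hcC, h0, rfl⟩
      exact hd c hcC h0
  · rintro d ⟨C, ⟨hdim, hleast⟩, hl⟩
    obtain ⟨c, hcC, h0, hw⟩ := exists_weight_le_tableEntry hk1 hkn hn hdim hl
    exact (hleast.2 ⟨c, hcC, h0, rfl⟩).trans (Nat.le_of_lt_succ hw)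

/-- If some code of dimension `k` has minimum distance at least `d`, then the largest minimum
distance is at least `d`. -/
lemma exists_isD4 {n k d : ℕ} (hk : 1 ≤ k) {C : Submodule F4 (Fin n → F4)}
    (hdim : Module.finrank F4 C = k) (hd : ∀ c ∈ C, c ≠ 0 → d ≤ weight c) :
    ∃ D, IsD4 n k D ∧ d ≤ D := by
  have hne : {w | ∃ c ∈ C, c ≠ 0 ∧ hammingNorm c = w}.Nonempty := by
    obtain ⟨c, hc, h0⟩ := exists_ne_zero_of_finrank_pos (C := C) (by omega)
    exact ⟨_, c, hc, h0, rfl⟩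
  have hmin : IsCode n k (sInf {w | ∃ c ∈ C, c ≠ 0 ∧ hammingNorm c = w}) C :=
    ⟨hdim, Nat.sInf_mem hne, fun w hw => Nat.sInf_le hw⟩
  obtain ⟨c, hc, h0, hcw⟩ := Nat.sInf_mem hne
  have hbdd : BddAbove {d | ∃ C : Submodule F4 (Fin n → F4), IsCode n k d C} := by
    refine ⟨n, ?_⟩
    rintro _ ⟨C', -, ⟨c', -, -, rfl⟩, -⟩
    exact weight_le c'
  refine ⟨sSup {d | ∃ C : Submodule F4 (Fin n → F4), IsCode n k d C},
    ⟨Nat.sSup_mem ⟨_, C, hmin⟩ hbdd, fun d hd => le_csSup hbdd hd⟩, ?_⟩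
  refine le_trans ?_ (le_csSup hbdd ⟨C, hmin⟩)
  rw [← hcw]
  exact hd c hc h0

end

end Quaternary

theorem mainTheorem6 :
    (∀ n k : ℕ, 1 ≤ k → k < n → n ≤ 12 →
      Quaternary.IsD4H n k 1 (Quaternary.tableEntry n k)) ∧
    (∀ n k : ℕ, (n, k) ∈ ({(10, 4), (11, 5), (11, 6)} : Set (ℕ × ℕ)) →
      ∃ a b : ℕ, Quaternary.IsD4H n k 1 a ∧ Quaternary.IsD4 n k b ∧ a < b) := by
  refine ⟨fun n k hk1 hkn hn => Quaternary.isD4H_tableEntry hk1 hkn hn, fun n k hnk => ?_⟩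
  have hlist : (n, k) ∈ [(10, 4), (11, 5), (11, 6)] := by simpa using hnk
  have hbound : 1 ≤ k ∧ k < n ∧ n ≤ 12 := by
    simp only [Set.mem_insert_iff, Set.mem_singleton_iff, Prod.mk.injEq] at hnk
    omega
  -- A code beating the table entry by one suffices; the exact unrestricted optimum is never
  -- computed.
  obtain ⟨hdim, hd⟩ := Quaternary.of_checkCode (Quaternary.checkCode_betterCode _ hlist)
  obtain ⟨D, hD, hle⟩ := Quaternary.exists_isD4 hbound.1 hdim hd
  exact ⟨_, D, Quaternary.isD4H_tableEntry hbound.1 hbound.2.1 hbound.2.2, hD, hle⟩
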